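/- **Notation.** $\|\cdot\|$ is the maximum norm of vectors and the induced matrix norm (largest absolute row sum); $\|v\|_{\mathcal L_\infty}$ and $\|v_\tau\|_{\mathcal L_\infty}$ are the $\mathcal L_\infty$ norms of $\|v(t)\|$ over $[0,\infty)$ and $[0,\tau]$. A transfer matrix is a matrix of real rational functions of $s$; it is stable if all its poles lie in the open left half-plane. For a stable proper transfer matrix $F(s)$ with impulse response $F_0\delta(t)+h(t)$, $\|F(s)\|_{\mathcal L_1}=\max_i\sum_j\big(|(F_0)_{ij}|+\int_0^\infty|h_{ij}(t)|\,dt\big)$. $N^\dagger=(N^\top N)^{-1}N^\top$ for $N$ of full column rank. **Plant.** Let $m\le p$; let $A_m\in\mathbb R^{n\times n}$ be Hurwitz, $B_m\in\mathbb R^{n\times m}$, $C_m\in\mathbb R^{p\times n}$, let $(A_m,B_m,C_m)$ be a minimal realization of $M(s)=C_m(s\mathbb I-A_m)^{-1}B_m$, and let $M(s)$ have full normal column rank $m$ and no transmission zeros in the closed right half-plane. Let $\mathcal C_\omega=[\omega_l,\omega_u]$ with $0<\omega_l<\omega_u$. Let $f:\mathbb R^n\times[0,\infty)\to\mathbb R^m$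 and $b_0>0$ satisfy $\|f(0,t)\|<b_0$ for $t\ge0$, and suppose that for every $\delta>0$ there are given $d_\delta,b_\delta>0$ such that $f$ is differentiable in $x$ and in $t$ with $\|\partial f/\partial x\|\le d_\delta$, $\|\partial f/\partial t\|\le b_\delta$ for all $\|x\|<\delta$, $t\ge0$. **Design.** Let $\rho_0,\bar\gamma,\alpha>0$, and $L_\delta=\frac{\delta+\bar\gamma}{\delta}\,d_{\delta+\bar\gamma}$ for $\delta>0$. Let $Z(s)=C_z(s\mathbb I-A_z)^{-1}B_z+D_z$ be an $m\times m$ transfer matrix, given by a minimal realization with $A_z\in\mathbb R^{n_z\times n_z}$ Hurwitz and $\det\begin{bmatrix}-s\mathbb I+A_z&B_z\\C_z&D_z\end{bmatrix}\ne0$ for all $s\in\mathbb C$, such that $Z^{-1}(s)$ is a right interactor of $sM(s)$, i.e. $\lim_{s\to\infty}sM(s)Z^{-1}(s)$ exists and has full rank. Let $T_z\in\mathbb R^{n\times n_z}$, of full column rank, and $\bar B\in\mathbb R^{n\times m}$ satisfy $$A_mT_z=T_zA_z+\bar BC_z,\quad C_mA_mT_z=C_m\bar BC_z,\quad B_m=T_zB_z+\bar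 BD_z,\quad C_mB_m=C_m\bar BD_z .$$ Let $H=\bar B(C_m\bar B)^\dagger$, and let $K_v$ be such that $A_v=(\mathbb I-HC_m)A_m+K_vC_m$ is Hurwitz. Let $P_y$, $Q$ and $P_v$ be positive definite with $A_v^\top P_v+P_vA_v=-Q$ and $0<\epsilon_q<\lambda_{\min}(Q)$. Put $\bar P_v=(\mathbb I-HC_m)^\top P_v(\mathbb I-HC_m)$ and $$\kappa_m=\sup_{t\ge0}\|e^{A_mt}\|,\qquad \kappa_y=\sqrt{n\,\tfrac{\lambda_{\max}(\bar P_v)}{\lambda_{\min}(P_y)}},\qquad \kappa_v=\sqrt{n\,\tfrac{\lambda_{\max}(\bar P_v)}{\lambda_{\min}(P_v)}} .$$ Let $r\in\mathcal L_\infty([0,\infty);\mathbb R^{m_r})$ and $K_g\in\mathbb R^{m\times m_r}$. Let $D(s)$ be an $m\times m$ transfer matrix such that, for all $\omega\in\mathcal C_\omega$, $\mathbb I+\omega D(s)$ is invertible and, with $C_0(s)=D(s)(\mathbb I+\omega D(s))^{-1}$ and $C(s)=\omega C_0(s)$, the matrix $C(s)$ is stable, $C(0)=\mathbb I$, and $C(s)Z^{-1}(s)$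 is strictly proper. Put $$H_0=(s\mathbb I-A_m)^{-1}B_m,\quad H_r=H_0CK_g,\quad G=H_0(\mathbb I-C),\quad H_1=\omega H_0C_1,\quad H_2=\omega H_0C_2,$$ $$C_1=(s+\alpha)C_0Z^{-1}(C_m\bar B)^\dagger,\qquad C_2=C_0Z^{-1}(C_m\bar B)^\dagger C_mA_m,$$ $$\rho_{ext}=\|H_r\|_{\mathcal L_1}\|r\|_{\mathcal L_\infty}+\|G\|_{\mathcal L_1}b_0,\quad \rho_{int}=(\kappa_m+\kappa_x)\rho_0,\quad \kappa_x=\|H_1\|_{\mathcal L_1}\kappa_y+\|H_2\|_{\mathcal L_1}\kappa_v .$$ Suppose that $\rho_r>0$ satisfies, for all $\omega\in\mathcal C_\omega$, $$\|G(s)\|_{\mathcal L_1}<\frac{\rho_r-\rho_{ext}-\rho_{int}}{L_{\rho_r}\,\rho_r}.$$ **Reference system.** For $\omega\in\mathcal C_\omega$ consider $$\dot x_{ref}(t)=A_mx_{ref}(t)+B_m\big(\omega u_{ref}(t)+f(x_{ref}(t),t)\big),\quad x_{ref}(0)=0,\qquad u_{ref}(s)=C_0(s)\big(K_gr(s)-\eta_{ref}(s)\big),$$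 where $\eta_{ref}(s)$ is the Laplace transform of $f(x_{ref}(t),t)$; that is, $u_{ref}$ is the zero-state response of $C_0(s)$ to $K_gr-f(x_{ref},\cdot)$. **Lemma 4.** For each $\omega\in\mathcal C_\omega$, $$\rho_{rx}=\rho_r-\frac{\rho_{int}}{1-\|G(s)\|_{\mathcal L_1}L_{\rho_r}}>0,$$ and for each $\tau>0$ every solution $(x_{ref},u_{ref})$ of the reference system on $[0,\tau]$ satisfies $$\|x_{ref,\tau}\|_{\mathcal L_\infty}\le\rho_{rx},\qquad \|u_{ref,\tau}\|_{\mathcal L_\infty}\le\rho_{ru},$$ where $\rho_{ru}=\|C_0(s)\|_{\mathcal L_1}(L_{\rho_r}\rho_{rx}+b_0)+\|C_0(s)K_g\|_{\mathcal L_1}\|r\|_{\mathcal L_\infty}$. -/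

import Mathlib

open MeasureTheory Filter Topology Matrix

open scoped ENNReal

noncomputable section

namespace L1Adaptive

/-! ### Matrices and signals

Vectors are functions `Fin k → ℝ`, whose Mathlib norm is the maximum norm. -/

/-- The matrix norm induced by the maximum norm (largest absolute row sum). -/
def matrixNorm {k l : ℕ} (M : Matrix (Fin k) (Fin l) ℝ) : ℝ := ⨆ i, ∑ j, |M i j|

/-- All (complex) eigenvalues lie in the open left half-plane. -/
def IsHurwitz {k : ℕ} (A : Matrix (Fin k) (Fin k) ℝ) : Prop :=
  ∀ z ∈ spectrum ℂ (A.map (algebraMap ℝ ℂ)), z.re < 0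

/-- `[B, A B, …, A ^ (k - 1) B]` has rank `k`. -/
def IsControllable {k l : ℕ} (A : Matrix (Fin k) (Fin k) ℝ) (B : Matrix (Fin k) (Fin l) ℝ) :
    Prop :=
  (Matrix.of fun (i : Fin k) (q : Fin k × Fin l) => (A ^ (q.1 : ℕ) * B) i q.2).rank = k

/-- `[C; C A; …; C A ^ (k - 1)]` has rank `k`. -/
def IsObservable {k l : ℕ} (A : Matrix (Fin k) (Fin k) ℝ) (C : Matrix (Fin l) (Fin k) ℝ) :
    Prop :=
  (Matrix.of fun (q : Fin k × Fin l) (i : Fin k) => (C * A ^ (q.1 : ℕ)) q.2 i).rank = k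

/-- The Moore–Penrose (left) inverse of a matrix of full column rank. -/
def leftPinv {k l : ℕ} (N : Matrix (Fin k) (Fin l) ℝ) : Matrix (Fin l) (Fin k) ℝ :=
  (Nᵀ * N)⁻¹ * Nᵀ

/-- Largest eigenvalue of a symmetric matrix. -/
def eigMax {k : ℕ} (P : Matrix (Fin k) (Fin k) ℝ) : ℝ := sSup (spectrum ℝ P)

/-- Smallest eigenvalue of a symmetric matrix. -/
def eigMin {k : ℕ} (P : Matrix (Fin k) (Fin k) ℝ) : ℝ := sInf (spectrum ℝ P)

/-- The truncated norm: the `L^∞` norm over `[0, τ]` of a vector signal. -/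
def truncNorm {k : ℕ} (τ : ℝ) (x : ℝ → Fin k → ℝ) : ℝ≥0∞ :=
  eLpNorm x ∞ (volume.restrict (Set.Icc 0 τ))

/-! ### Rational transfer matrices -/

/-- A `k × l` transfer matrix: a matrix of real rational functions of `s`. -/
abbrev TransferMatrix (k l : ℕ) : Type := Matrix (Fin k) (Fin l) (RatFunc ℝ)

/-- A real matrix as a constant transfer matrix. -/
def const {k l : ℕ} (M : Matrix (Fin k) (Fin l) ℝ) : TransferMatrix k l := M.map RatFunc.C

/-- `(s I - A)⁻¹`. -/
def resolvent {k : ℕ} (A : Matrix (Fin k) (Fin k) ℝ) : TransferMatrix k k :=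
  ((RatFunc.X : RatFunc ℝ) • (1 : TransferMatrix k k) - const A)⁻¹

/-- Every pole of every entry lies in the open left half-plane. -/
def IsStable {k l : ℕ} (G : TransferMatrix k l) : Prop :=
  ∀ i j, ∀ z : ℂ, Polynomial.aeval z (G i j).denom = 0 → z.re < 0

/-- Every entry has a numerator of smaller degree than its denominator. -/
def IsStrictlyProper {k l : ℕ} (G : TransferMatrix k l) : Prop :=
  ∀ i j, (G i j).num.degree < (G i j).denom.degree

/-- The value `G(0)`. -/
def evalZero {k l : ℕ} (G : TransferMatrix k l) : Matrix (Fin k) (Fin l) ℝ :=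
  G.map (RatFunc.eval (RingHom.id ℝ) 0)

/-- `W` is a right interactor of `M₀`: the limit of `M₀(s) W(s)` as `s → ∞` exists and has full
(column) rank. -/
def IsRightInteractor {k l : ℕ} (M₀ : TransferMatrix k l) (W : TransferMatrix l l) : Prop :=
  ∃ E : Matrix (Fin k) (Fin l) ℝ, E.rank = l ∧ ∀ i j,
    Tendsto (fun s : ℂ => RatFunc.eval (algebraMap ℝ ℂ) s ((M₀ * W) i j))
      (Bornology.cobounded ℂ) (𝓝 (E i j : ℂ))

/-- The expansion of a rational function at infinity, as a Laurent series in `1 / s`: the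
coefficient of index `k` is the coefficient of `s ^ (-k)`. -/
def expansionAtInfinity (g : RatFunc ℝ) : LaurentSeries ℝ :=
  RatFunc.eval (HahnSeries.C : ℝ →+* LaurentSeries ℝ) (HahnSeries.single (-1 : ℤ) (1 : ℝ)) g

/-- The direct feedthrough `g(∞)` of a proper rational function `g`. -/
def feedthrough (g : RatFunc ℝ) : ℝ := (expansionAtInfinity g).coeff 0

/-- The impulse response (inverse Laplace transform) of the strictly proper part of `g`: as
`s ^ (-(k + 1))` is the Laplace transform of `t ^ k / k!`, it is `∑ k, g_{k+1} t ^ k / k!` for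
`g(s) = g_0 + ∑ k, g_{k+1} s ^ (-(k + 1))`. -/
def impulseResponse (g : RatFunc ℝ) (t : ℝ) : ℝ :=
  ∑' k : ℕ, (expansionAtInfinity g).coeff ((k : ℤ) + 1) * t ^ k / (k.factorial : ℝ)

/-- The `L¹` norm of a stable proper transfer function: total variation of the impulse response
`g_0 δ(t) + h(t)`. -/
def l1NormEntry (g : RatFunc ℝ) : ℝ :=
  |feedthrough g| + ∫ t in Set.Ioi (0 : ℝ), |impulseResponse g t|

/-- The `L¹` norm of a stable proper transfer matrix: the largest row sum. -/
def l1Norm {k l : ℕ} (G : TransferMatrix k l) : ℝ := ⨆ i, ∑ j, l1NormEntry (G i j)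

/-- The signal `y` with `y(s) = G(s) v(s)`: the zero-state response (convolution with the impulse
response) of a proper transfer matrix `G` to the input `v` on `[0, ∞)`. -/
def response {k l : ℕ} (G : TransferMatrix k l) (v : ℝ → Fin l → ℝ) (t : ℝ) : Fin k → ℝ :=
  fun i => ∑ j, (feedthrough (G i j) * v t j +
    ∫ s in (0 : ℝ)..t, impulseResponse (G i j) (t - s) * v s j)

/-! ### The plant, the controller design and the reference system -/

/-- The data of the problem: `n` states, `m` inputs, `p` outputs, an interactor of order `nz` and
`mr` reference commands. The conditions on the data are in `Admissible`. -/
structure Design (n m p nz mr : ℕ) where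
  /-- plant matrices -/
  Am : Matrix (Fin n) (Fin n) ℝ
  Bm : Matrix (Fin n) (Fin m) ℝ
  Cm : Matrix (Fin p) (Fin n) ℝ
  /-- bounds of the unknown input gain -/
  ωl : ℝ
  ωu : ℝ
  /-- matched uncertainty and its known bounds -/
  f : (Fin n → ℝ) → ℝ → Fin m → ℝ
  b₀ : ℝ
  d : ℝ → ℝ
  b : ℝ → ℝ
  /-- bound of the initial condition of the plant, and the small constant `γ̄` -/
  ρ₀ : ℝ
  γbar : ℝ
  /-- realization of `Z(s)`, and the associated matrices `T_z`, `B̄` -/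
  Az : Matrix (Fin nz) (Fin nz) ℝ
  Bz : Matrix (Fin nz) (Fin m) ℝ
  Cz : Matrix (Fin m) (Fin nz) ℝ
  Dz : Matrix (Fin m) (Fin m) ℝ
  Tz : Matrix (Fin n) (Fin nz) ℝ
  Bbar : Matrix (Fin n) (Fin m) ℝ
  /-- predictor gain and Lyapunov matrices -/
  Kv : Matrix (Fin n) (Fin p) ℝ
  Py : Matrix (Fin p) (Fin p) ℝ
  Pv : Matrix (Fin n) (Fin n) ℝ
  Q : Matrix (Fin n) (Fin n) ℝ
  εq : ℝ
  α : ℝ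
  /-- filter, feed-forward gain and reference command -/
  D : TransferMatrix m m
  Kg : Matrix (Fin m) (Fin mr) ℝ
  r : ℝ → Fin mr → ℝ
  ρr : ℝ

namespace Design

variable {n m p nz mr : ℕ} (S : Design n m p nz mr)

/-- `H₀(s) = (s I - A_m)⁻¹ B_m`. -/
def H₀ : TransferMatrix n m := resolvent S.Am * const S.Bm

/-- `M(s) = C_m (s I - A_m)⁻¹ B_m`. -/
def M : TransferMatrix p m := const S.Cm * resolvent S.Am * const S.Bm

/-- `Z(s) = C_z (s I - A_z)⁻¹ B_z + D_z`. -/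
def Z : TransferMatrix m m := const S.Cz * resolvent S.Az * const S.Bz + const S.Dz

/-- `H = B̄ (C_m B̄)†`. -/
def H : Matrix (Fin n) (Fin p) ℝ := S.Bbar * leftPinv (S.Cm * S.Bbar)

/-- `A_H = (I - H C_m) A_m`. -/
def AH : Matrix (Fin n) (Fin n) ℝ := (1 - S.H * S.Cm) * S.Am

/-- `A_v = A_H + K_v C_m`. -/
def Av : Matrix (Fin n) (Fin n) ℝ := S.AH + S.Kv * S.Cm

/-- `P̄_v = (I - H C_m)ᵀ P_v (I - H C_m)`. -/
def Pvbar : Matrix (Fin n) (Fin n) ℝ := (1 - S.H * S.Cm)ᵀ * S.Pv * (1 - S.H * S.Cm)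

/-- `L_δ = (δ + γ̄) / δ * d_{δ + γ̄}`. -/
def L (δ : ℝ) : ℝ := (δ + S.γbar) / δ * S.d (δ + S.γbar)

/-- `κ_m = sup_{t ≥ 0} ‖exp (A_m t)‖`. -/
def κm : ℝ := ⨆ t : Set.Ici (0 : ℝ), matrixNorm (NormedSpace.exp ((t : ℝ) • S.Am))

def κy : ℝ := Real.sqrt (n * (eigMax S.Pvbar / eigMin S.Py))

def κv : ℝ := Real.sqrt (n * (eigMax S.Pvbar / eigMin S.Pv))

/-- `C₀(s) = D(s) (I + ω D(s))⁻¹`. -/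
def C₀ (ω : ℝ) : TransferMatrix m m := S.D * (1 + RatFunc.C ω • S.D)⁻¹

/-- `C(s) = ω C₀(s)`. -/
def C (ω : ℝ) : TransferMatrix m m := RatFunc.C ω • S.C₀ ω

/-- `C₁(s) = (s + α) C₀(s) Z⁻¹(s) (C_m B̄)†`. -/
def C₁ (ω : ℝ) : TransferMatrix m p :=
  (RatFunc.X + RatFunc.C S.α) • (S.C₀ ω * S.Z⁻¹ * const (leftPinv (S.Cm * S.Bbar)))

/-- `C₂(s) = C₀(s) Z⁻¹(s) (C_m B̄)† C_m A_m`. -/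
def C₂ (ω : ℝ) : TransferMatrix m n :=
  S.C₀ ω * S.Z⁻¹ * const (leftPinv (S.Cm * S.Bbar) * S.Cm * S.Am)

def Hr (ω : ℝ) : TransferMatrix n mr := S.H₀ * S.C ω * const S.Kg

def H₁ (ω : ℝ) : TransferMatrix n p := RatFunc.C ω • (S.H₀ * S.C₁ ω)

def H₂ (ω : ℝ) : TransferMatrix n n := RatFunc.C ω • (S.H₀ * S.C₂ ω)

/-- `G(s) = H₀(s) (I - C(s))`. -/
def G (ω : ℝ) : TransferMatrix n m := S.H₀ * (1 - S.C ω)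

/-- The `L^∞` norm over `[0, ∞)` of the reference command. -/
def rNorm : ℝ := (eLpNorm S.r ∞ (volume.restrict (Set.Ici 0))).toReal

def ρext (ω : ℝ) : ℝ := l1Norm (S.Hr ω) * S.rNorm + l1Norm (S.G ω) * S.b₀

def κx (ω : ℝ) : ℝ := l1Norm (S.H₁ ω) * S.κy + l1Norm (S.H₂ ω) * S.κv

def ρint (ω : ℝ) : ℝ := (S.κm + S.κx ω) * S.ρ₀

def ρrx (ω : ℝ) : ℝ := S.ρr - S.ρint ω / (1 - l1Norm (S.G ω) * S.L S.ρr)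

def ρru (ω : ℝ) : ℝ :=
  l1Norm (S.C₀ ω) * (S.L S.ρr * S.ρrx ω + S.b₀) + l1Norm (S.C₀ ω * const S.Kg) * S.rNorm

/-- The standing assumptions on the plant: `A_m` is Hurwitz, `(A_m, B_m, C_m)` is minimal, `M(s)`
has full normal column rank and no unstable transmission zeros, the range of the input gain is a
compact interval of positive numbers, and `f` is semi-globally Lipschitz. -/
structure PlantAssumptions : Prop where
  m_le_p : m ≤ p
  Am_hurwitz : IsHurwitz S.Am
  controllable : IsControllable S.Am S.Bm
  observable : IsObservable S.Am S.Cm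
  full_rank : S.M.rank = m
  /-- The transmission zeros are the points where the system matrix drops rank. -/
  no_unstable_zeros : ∀ s : ℂ, 0 ≤ s.re →
    (Matrix.fromBlocks (s • 1 - S.Am.map (algebraMap ℝ ℂ)) (S.Bm.map (algebraMap ℝ ℂ))
      (-(S.Cm.map (algebraMap ℝ ℂ))) 0).rank = n + m
  ωl_pos : 0 < S.ωl
  ωl_lt_ωu : S.ωl < S.ωu
  b₀_pos : 0 < S.b₀
  f_zero : ∀ t, 0 ≤ t → ‖S.f 0 t‖ < S.b₀
  d_pos : ∀ δ, 0 < δ → 0 < S.d δ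
  b_pos : ∀ δ, 0 < δ → 0 < S.b δ
  /-- `‖∂f/∂x‖ ≤ d_δ` for `‖x‖ < δ`. -/
  f_space : ∀ δ, 0 < δ → ∀ x, ‖x‖ < δ → ∀ t, 0 ≤ t →
    DifferentiableAt ℝ (fun y => S.f y t) x ∧ ‖fderiv ℝ (fun y => S.f y t) x‖ ≤ S.d δ
  /-- `‖∂f/∂t‖ ≤ b_δ` for `‖x‖ < δ`. -/
  f_time : ∀ δ, 0 < δ → ∀ x, ‖x‖ < δ → ∀ t, 0 ≤ t →
    DifferentiableWithinAt ℝ (S.f x) (Set.Ici 0) t ∧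
      ‖derivWithin (S.f x) (Set.Ici 0) t‖ ≤ S.b δ

/-- `Z⁻¹(s)` is a right interactor of `s M(s)`; `(A_z, B_z, C_z, D_z)` is a minimal stable
realization of `Z(s)` without finite zeros, with associated matrices `T_z` and `B̄`. -/
structure InteractorConditions : Prop where
  interactor : IsRightInteractor ((RatFunc.X : RatFunc ℝ) • S.M) S.Z⁻¹
  Az_hurwitz : IsHurwitz S.Az
  controllable : IsControllable S.Az S.Bz
  observable : IsObservable S.Az S.Cz
  no_zeros : ∀ s : ℂ,
    (Matrix.fromBlocks (-(s • 1) + S.Az.map (algebraMap ℝ ℂ)) (S.Bz.map (algebraMap ℝ ℂ))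
      (S.Cz.map (algebraMap ℝ ℂ)) (S.Dz.map (algebraMap ℝ ℂ))).det ≠ 0
  Tz_rank : S.Tz.rank = nz
  Am_Tz : S.Am * S.Tz = S.Tz * S.Az + S.Bbar * S.Cz
  Cm_Am_Tz : S.Cm * S.Am * S.Tz = S.Cm * S.Bbar * S.Cz
  Bm_eq : S.Bm = S.Tz * S.Bz + S.Bbar * S.Dz
  Cm_Bm : S.Cm * S.Bm = S.Cm * S.Bbar * S.Dz

/-- The design constraints. -/
structure Admissible : Prop where
  plant : S.PlantAssumptions
  interactor : S.InteractorConditions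
  ρ₀_pos : 0 < S.ρ₀
  γbar_pos : 0 < S.γbar
  Av_hurwitz : IsHurwitz S.Av
  Py_posDef : S.Py.PosDef
  Pv_posDef : S.Pv.PosDef
  Q_posDef : S.Q.PosDef
  εq_pos : 0 < S.εq
  εq_lt : S.εq < eigMin S.Q
  lyapunov : S.Avᵀ * S.Pv + S.Pv * S.Av = -S.Q
  α_pos : 0 < S.α
  /-- The reference command is a bounded (measurable) signal on `[0, ∞)`. -/
  r_bounded : MemLp S.r ∞ (volume.restrict (Set.Ici 0))
  filter_wellPosed : ∀ ω ∈ Set.Icc S.ωl S.ωu, (1 + RatFunc.C ω • S.D).det ≠ 0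
  filter_stable : ∀ ω ∈ Set.Icc S.ωl S.ωu, IsStable (S.C ω)
  filter_dcGain : ∀ ω ∈ Set.Icc S.ωl S.ωu, evalZero (S.C ω) = 1
  filter_strictlyProper : ∀ ω ∈ Set.Icc S.ωl S.ωu, IsStrictlyProper (S.C ω * S.Z⁻¹)
  ρr_pos : 0 < S.ρr
  /-- The `L¹`-norm condition. -/
  l1_condition : ∀ ω ∈ Set.Icc S.ωl S.ωu,
    l1Norm (S.G ω) < (S.ρr - S.ρext ω - S.ρint ω) / (S.L S.ρr * S.ρr)

/-- `(x, u)` solves the closed-loop reference system on `[0, τ]` for the input gain `ω`: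
`x' = A_m x + B_m (ω u + f(x, t))`, `x(0) = 0`, `u(s) = C₀(s) (K_g r(s) - η(s))`, where `η(s)` is
the Laplace transform of `f(x(t), t)`. -/
structure IsReferenceSolution (ω τ : ℝ) (x : ℝ → Fin n → ℝ) (u : ℝ → Fin m → ℝ) : Prop where
  init : x 0 = 0
  ode : ∀ t ∈ Set.Icc 0 τ,
    HasDerivWithinAt x (S.Am *ᵥ x t + S.Bm *ᵥ (ω • u t + S.f (x t) t)) (Set.Icc 0 τ) t
  control : ∀ t ∈ Set.Icc 0 τ,
    u t = response (S.C₀ ω) (fun s => S.Kg *ᵥ S.r s - S.f (x s) s) t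

end Design

end L1Adaptive

end

noncomputable section

namespace L1Adaptive

/-!
With `η(t) = f(x(t), t)`, a solution of the reference system obeys `x = H_r r + G η`: the right-hand
side solves the same linear equation `x' = A_m x + B_m (ω u + η)`, because `s F = A F + B W` for
`F = (s I - A)⁻¹ B W`. While `‖x‖ ≤ ρ_r` one has `‖η‖ ≤ L ‖x‖ + b₀`, so
`sup ‖x‖ ≤ ρ_ext + ‖G‖ L sup ‖x‖`, and a first-exit argument turns this into
`‖x‖ ≤ ρ_ext / (1 - ‖G‖ L) < ρ_rx`.

These bounds need the `L¹` norms to be finite. The impulse response of a rational function is the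
exponential generating function of its expansion at infinity, a sequence satisfying the linear
recurrence whose characteristic roots are the poles; stability makes it decay exponentially.
-/

/-! ### Exponential generating functions -/

section ExpSeries

variable {E : Type*} [NormedAddCommGroup E]

/-- The exponential generating function `∑ k, t ^ k / k! • c k` of a sequence `c`; the impulse
response of a rational function is that of its expansion at infinity. -/
def expSeries [NormedSpace ℝ E] (c : ℕ → E) (t : ℝ) : E :=
  ∑' k : ℕ, (t ^ k / (k.factorial : ℝ)) • c k

/-- Sequences dominated by a geometric sequence: those whose exponential generating function is
dominated termwise by an exponential series. -/
def HasGeometricGrowth (c : ℕ → E) : Prop :=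
  ∃ K R : ℝ, 0 ≤ K ∧ 0 ≤ R ∧ ∀ k, ‖c k‖ ≤ K * R ^ k

theorem hasGeometricGrowth_zero : HasGeometricGrowth (0 : ℕ → E) :=
  ⟨0, 0, le_rfl, le_rfl, by simp⟩

theorem HasGeometricGrowth.shift {c : ℕ → E} (hc : HasGeometricGrowth c) :
    HasGeometricGrowth fun k => c (k + 1) := by
  obtain ⟨K, R, hK, hR, h⟩ := hc
  exact ⟨K * R, R, by positivity, hR, fun k => (h (k + 1)).trans_eq (by ring)⟩

theorem HasGeometricGrowth.const_smul {𝕜 : Type*} [NormedField 𝕜] [NormedSpace 𝕜 E] {c : ℕ → E}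
    (hc : HasGeometricGrowth c) (a : 𝕜) : HasGeometricGrowth fun k => a • c k := by
  obtain ⟨K, R, hK, hR, h⟩ := hc
  refine ⟨‖a‖ * K, R, by positivity, hR, fun k => ?_⟩
  rw [norm_smul, mul_assoc]
  exact mul_le_mul_of_nonneg_left (h k) (norm_nonneg a)

theorem HasGeometricGrowth.of_first_order {𝕜 : Type*} [NormedField 𝕜] [NormedSpace 𝕜 E]
    {c w : ℕ → E} {a : 𝕜} (hc : ∀ k, c (k + 1) = a • c k + w k) (hw : HasGeometricGrowth w) :
    HasGeometricGrowth c := by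
  obtain ⟨K, R, hK, hR, hw⟩ := hw
  have ha := norm_nonneg a
  refine ⟨‖c 0‖ + K, ‖a‖ + R + 1, by positivity, by positivity, fun k => ?_⟩
  induction k with
  | zero => simpa using hK
  | succ k ih =>
    have hwk : ‖w k‖ ≤ (‖c 0‖ + K) * (‖a‖ + R + 1) ^ k := by
      refine (hw k).trans ?_
      gcongr <;> linarith [norm_nonneg (c 0)]
    calc ‖c (k + 1)‖ ≤ ‖a‖ * ‖c k‖ + ‖w k‖ := by
          rw [hc k, ← norm_smul]; exact norm_add_le _ _
      _ ≤ ‖a‖ * ((‖c 0‖ + K) * (‖a‖ + R + 1) ^ k) + (‖c 0‖ + K) * (‖a‖ + R + 1) ^ k := by gcongr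
      _ = (‖a‖ + 1) * ((‖c 0‖ + K) * (‖a‖ + R + 1) ^ k) := by ring
      _ ≤ (‖a‖ + R + 1) * ((‖c 0‖ + K) * (‖a‖ + R + 1) ^ k) := by gcongr; linarith
      _ = (‖c 0‖ + K) * (‖a‖ + R + 1) ^ (k + 1) := by ring

variable [NormedSpace ℝ E]

theorem norm_expSeries_term_le {c : ℕ → E} {K R T t : ℝ} (hc : ∀ k, ‖c k‖ ≤ K * R ^ k)
    (ht : |t| ≤ T) (k : ℕ) :
    ‖(t ^ k / (k.factorial : ℝ)) • c k‖ ≤ K * ((T * R) ^ k / (k.factorial : ℝ)) := by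
  have hT : 0 ≤ T := (abs_nonneg t).trans ht
  calc ‖(t ^ k / (k.factorial : ℝ)) • c k‖ = |t| ^ k / (k.factorial : ℝ) * ‖c k‖ := by
        rw [norm_smul, norm_div, norm_pow, Real.norm_eq_abs, Real.norm_natCast]
    _ ≤ T ^ k / (k.factorial : ℝ) * (K * R ^ k) := by gcongr; exact hc k
    _ = K * ((T * R) ^ k / (k.factorial : ℝ)) := by rw [mul_pow]; ring

theorem hasDerivAt_pow_succ_div_factorial (k : ℕ) (t : ℝ) :
    HasDerivAt (fun y : ℝ => y ^ (k + 1) / ((k + 1).factorial : ℝ))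
      (t ^ k / (k.factorial : ℝ)) t := by
  refine ((hasDerivAt_pow (k + 1) t).div_const _).congr_deriv ?_
  rw [Nat.factorial_succ]
  push_cast
  field_simp

variable [CompleteSpace E]

theorem HasGeometricGrowth.summable {c : ℕ → E} (hc : HasGeometricGrowth c) (t : ℝ) :
    Summable fun k : ℕ => (t ^ k / (k.factorial : ℝ)) • c k := by
  obtain ⟨K, R, -, -, h⟩ := hc
  exact .of_norm_bounded ((Real.summable_pow_div_factorial (|t| * R)).mul_left K)
    fun k => norm_expSeries_term_le h le_rfl k

theorem HasGeometricGrowth.expSeries_eq_add {c : ℕ → E} (hc : HasGeometricGrowth c) (t : ℝ) :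
    expSeries c t = c 0 + ∑' k : ℕ, (t ^ (k + 1) / ((k + 1).factorial : ℝ)) • c (k + 1) := by
  rw [expSeries, (hc.summable t).tsum_eq_zero_add]
  simp

theorem HasGeometricGrowth.expSeries_zero {c : ℕ → E} (hc : HasGeometricGrowth c) :
    expSeries c 0 = c 0 := by
  simp [hc.expSeries_eq_add]

theorem HasGeometricGrowth.expSeries_add {c d : ℕ → E} (hc : HasGeometricGrowth c)
    (hd : HasGeometricGrowth d) (t : ℝ) :
    expSeries (fun k => c k + d k) t = expSeries c t + expSeries d t := by
  simp only [expSeries, smul_add]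
  exact (hc.summable t).tsum_add (hd.summable t)

theorem HasGeometricGrowth.expSeries_const_smul {𝕜 : Type*} [NormedField 𝕜] [NormedSpace 𝕜 E]
    [SMulCommClass ℝ 𝕜 E] {c : ℕ → E} (hc : HasGeometricGrowth c) (a : 𝕜) (t : ℝ) :
    expSeries (fun k => a • c k) t = a • expSeries c t := by
  simp only [expSeries, smul_comm _ a]
  exact (hc.summable t).tsum_const_smul a

theorem HasGeometricGrowth.hasDerivAt_expSeries {c : ℕ → E} (hc : HasGeometricGrowth c) (t : ℝ) :
    HasDerivAt (expSeries c) (expSeries (fun k => c (k + 1)) t) t := by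
  have hsplit : expSeries c = fun y =>
      c 0 + ∑' k : ℕ, (y ^ (k + 1) / ((k + 1).factorial : ℝ)) • c (k + 1) :=
    funext hc.expSeries_eq_add
  rw [hsplit]
  refine HasDerivAt.const_add _ ?_
  obtain ⟨K, R, -, -, h⟩ := hc.shift
  have h0 : (0 : ℝ) ∈ Metric.ball 0 (|t| + 1) := Metric.mem_ball_self (by positivity)
  have ht : t ∈ Metric.ball 0 (|t| + 1) := by simp
  refine hasDerivAt_tsum_of_isPreconnected
    ((Real.summable_pow_div_factorial ((|t| + 1) * R)).mul_left K) Metric.isOpen_ball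
    (convex_ball _ _).isPreconnected
    (fun k y _ => (hasDerivAt_pow_succ_div_factorial k y).smul_const (c (k + 1)))
    (fun k y hy => norm_expSeries_term_le h ?_ k) h0 (by simp) ht
  simpa using (Metric.mem_ball.1 hy).le

end ExpSeries

/-! ### Linear recurrences with constant coefficients -/

section Recurrence

variable {R : Type*} [CommRing R]

/-- The shift of sequences. A sequence satisfies the linear recurrence with characteristic
polynomial `q` if and only if it is annihilated by `aeval (shiftEnd R) q`. -/
def shiftEnd (R : Type*) [CommRing R] : Module.End R (ℕ → R) := LinearMap.funLeft R R Nat.succ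

theorem shiftEnd_apply (c : ℕ → R) (k : ℕ) : shiftEnd R c k = c (k + 1) := rfl

theorem shiftEnd_pow_apply (c : ℕ → R) (i k : ℕ) : (shiftEnd R ^ i) c k = c (k + i) := by
  induction i generalizing k with
  | zero => rfl
  | succ i ih => rw [pow_succ', Module.End.mul_apply, shiftEnd_apply, ih, add_right_comm, add_assoc]

theorem aeval_shiftEnd_apply (q : Polynomial R) (c : ℕ → R) (k : ℕ) :
    Polynomial.aeval (shiftEnd R) q c k = q.sum fun i a => a * c (k + i) := by
  rw [Polynomial.aeval_eq_sum_range, Polynomial.sum_over_range _ (fun _ => by simp)]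
  simp [shiftEnd_pow_apply]

theorem aeval_shiftEnd_X_sub_C_mul (a : R) (q : Polynomial R) (c : ℕ → R) :
    Polynomial.aeval (shiftEnd R) ((Polynomial.X - Polynomial.C a) * q) c =
      Polynomial.aeval (shiftEnd R) q (fun k => c (k + 1) - a * c k) := by
  rw [mul_comm, map_mul, Module.End.mul_apply]
  congr 1
  ext k
  simp [shiftEnd_apply]

theorem aeval_shiftEnd_prod_roots {𝕜 : Type*} [Field 𝕜] {q : Polynomial 𝕜} (hq : q ≠ 0)
    (hsplits : q.Splits) {c : ℕ → 𝕜} (hc : Polynomial.aeval (shiftEnd 𝕜) q c = 0) :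
    Polynomial.aeval (shiftEnd 𝕜) (q.roots.map fun a => Polynomial.X - Polynomial.C a).prod c =
      0 := by
  rw [hsplits.eq_prod_roots, map_mul, Module.End.mul_apply, Polynomial.aeval_C,
    Module.algebraMap_end_apply] at hc
  exact (smul_eq_zero.1 hc).resolve_left (Polynomial.leadingCoeff_ne_zero.2 hq)

theorem HasGeometricGrowth.of_prod_X_sub_C {𝕜 : Type*} [NormedField 𝕜] (s : Multiset 𝕜)
    (c : ℕ → 𝕜)
    (hc : Polynomial.aeval (shiftEnd 𝕜) (s.map fun a => Polynomial.X - Polynomial.C a).prod c = 0) :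
    HasGeometricGrowth c := by
  induction s using Multiset.induction generalizing c with
  | empty =>
    obtain rfl : c = 0 := by simpa using hc
    exact hasGeometricGrowth_zero
  | cons a s ih =>
    rw [Multiset.map_cons, Multiset.prod_cons, aeval_shiftEnd_X_sub_C_mul] at hc
    exact .of_first_order (a := a) (fun k => by rw [smul_eq_mul]; ring) (ih _ hc)

theorem norm_le_of_norm_deriv_le_exp {E : Type*} [NormedAddCommGroup E] [NormedSpace ℝ E]
    {f f' : ℝ → E} {K μ t : ℝ} (hμ : 0 < μ) (hf : ∀ s, HasDerivAt f (f' s) s)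
    (hf' : ∀ s, 0 ≤ s → ‖f' s‖ ≤ K * Real.exp (μ * s)) (ht : 0 ≤ t) :
    ‖f t‖ ≤ ‖f 0‖ + K / μ * Real.exp (μ * t) := by
  have hK : 0 ≤ K := by simpa using (norm_nonneg _).trans (hf' 0 le_rfl)
  have hB (s : ℝ) : HasDerivAt (fun y => ‖f 0‖ + K / μ * Real.exp (μ * y))
      (K * Real.exp (μ * s)) s := by
    have hexp : HasDerivAt (fun y => Real.exp (μ * y)) (Real.exp (μ * s) * μ) s :=
      (hasDerivAt_const_mul μ).exp
    refine ((hexp.const_mul (K / μ)).const_add _).congr_deriv ?_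
    field_simp
  refine image_norm_le_of_norm_deriv_right_le_deriv_boundary (a := 0) (b := t)
    (B := fun s => ‖f 0‖ + K / μ * Real.exp (μ * s))
    (fun s _ => (hf s).continuousAt.continuousWithinAt) (fun s _ => (hf s).hasDerivWithinAt)
    (le_add_of_nonneg_right (by positivity)) hB (fun s hs => hf' s hs.1) (Set.right_mem_Icc.2 ht)

theorem hasDerivAt_exp_neg_mul_mul {h w : ℝ → ℂ} {a : ℂ} {t : ℝ}
    (hh : HasDerivAt h (a * h t + w t) t) :
    HasDerivAt (fun s : ℝ => Complex.exp (-a * s) * h s) (Complex.exp (-a * t) * w t) t := by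
  have hlin : HasDerivAt (fun s : ℝ => -a * (s : ℂ)) (-a) t := by
    simpa using (Complex.ofRealCLM.hasDerivAt (x := t)).const_mul (-a)
  exact (hlin.cexp.mul hh).congr_deriv (by ring)

theorem exists_norm_le_exp_of_first_order {h w : ℝ → ℂ} {a : ℂ} {ε K : ℝ} (ha : a.re < -ε)
    (hh : ∀ t, HasDerivAt h (a * h t + w t) t)
    (hw : ∀ t, 0 ≤ t → ‖w t‖ ≤ K * Real.exp (-ε * t)) :
    ∃ K', ∀ t, 0 ≤ t → ‖h t‖ ≤ K' * Real.exp (-ε * t) := by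
  set μ := -ε - a.re with hμ
  have hnorm (t : ℝ) : ‖Complex.exp (-a * t)‖ = Real.exp (-a.re * t) := by simp [Complex.norm_exp]
  have hμt (t : ℝ) : Real.exp (μ * t) = Real.exp (-a.re * t) * Real.exp (-ε * t) := by
    rw [← Real.exp_add, hμ]; ring_nf
  refine ⟨‖h 0‖ + K / μ, fun t ht => ?_⟩
  have hψ : ‖Complex.exp (-a * t) * h t‖ ≤ ‖h 0‖ + K / μ * Real.exp (μ * t) := by
    simpa using norm_le_of_norm_deriv_le_exp (by linarith)
      (fun s => hasDerivAt_exp_neg_mul_mul (hh s))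
      (fun s hs => by
        rw [norm_mul, hnorm, hμt, mul_left_comm]
        exact mul_le_mul_of_nonneg_left (hw s hs) (Real.exp_nonneg _)) ht
  have hre : 1 ≤ Real.exp (μ * t) := Real.one_le_exp (mul_nonneg (by linarith) ht)
  refine le_of_mul_le_mul_left ?_ (Real.exp_pos (-a.re * t))
  calc Real.exp (-a.re * t) * ‖h t‖ ≤ ‖h 0‖ + K / μ * Real.exp (μ * t) := by
        rwa [norm_mul, hnorm] at hψ
    _ ≤ ‖h 0‖ * Real.exp (μ * t) + K / μ * Real.exp (μ * t) := by
        gcongr; exact le_mul_of_one_le_right (norm_nonneg _) hre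
    _ = Real.exp (-a.re * t) * ((‖h 0‖ + K / μ) * Real.exp (-ε * t)) := by rw [hμt]; ring

theorem exists_norm_expSeries_le_exp_of_prod_X_sub_C {s : Multiset ℂ} {ε : ℝ}
    (hs : ∀ a ∈ s, a.re < -ε) {c : ℕ → ℂ}
    (hc : Polynomial.aeval (shiftEnd ℂ) (s.map fun a => Polynomial.X - Polynomial.C a).prod c = 0) :
    ∃ K, ∀ t, 0 ≤ t → ‖expSeries c t‖ ≤ K * Real.exp (-ε * t) := by
  induction s using Multiset.induction generalizing c with
  | empty =>
    obtain rfl : c = 0 := by simpa using hc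
    exact ⟨0, by simp [expSeries]⟩
  | cons a s ih =>
    have hgrowth := HasGeometricGrowth.of_prod_X_sub_C _ _ hc
    rw [Multiset.map_cons, Multiset.prod_cons, aeval_shiftEnd_X_sub_C_mul] at hc
    have hgrowth' := HasGeometricGrowth.of_prod_X_sub_C _ _ hc
    obtain ⟨K, hK⟩ := ih (fun b hb => hs b (Multiset.mem_cons_of_mem hb)) hc
    refine exists_norm_le_exp_of_first_order (hs a (Multiset.mem_cons_self a s)) (fun t => ?_) hK
    refine (hgrowth.hasDerivAt_expSeries t).congr_deriv ?_
    calc expSeries (fun k => c (k + 1)) t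
        = expSeries (fun k => a • c k + (c (k + 1) - a * c k)) t := by simp
      _ = a * expSeries c t + expSeries (fun k => c (k + 1) - a * c k) t := by
          rw [(hgrowth.const_smul a).expSeries_add hgrowth', hgrowth.expSeries_const_smul,
            smul_eq_mul]

theorem exists_forall_re_lt_neg {s : Multiset ℂ} (hs : ∀ a ∈ s, a.re < 0) :
    ∃ ε, 0 < ε ∧ ∀ a ∈ s, a.re < -ε := by
  have hfin : ∀ᶠ ε in 𝓝[>] (0 : ℝ), ∀ a ∈ s.toFinset, a.re < -ε := by
    refine (Finset.eventually_all _).2 fun a ha => ?_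
    have hlt : ∀ᶠ ε in 𝓝 (0 : ℝ), a.re < -ε := by
      refine continuous_neg.continuousAt.eventually_const_lt ?_
      simpa using hs a (Multiset.mem_toFinset.1 ha)
    exact hlt.filter_mono nhdsWithin_le_nhds
  obtain ⟨ε, h, hε⟩ := (hfin.and self_mem_nhdsWithin).exists
  exact ⟨ε, hε, fun a ha => h a (Multiset.mem_toFinset.2 ha)⟩

theorem exists_norm_expSeries_le_exp_of_recurrence {q : Polynomial ℂ} (hq : q ≠ 0)
    (hroots : ∀ z ∈ q.roots, z.re < 0) {c : ℕ → ℂ}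
    (hc : Polynomial.aeval (shiftEnd ℂ) q c = 0) :
    ∃ K ε, 0 < ε ∧ ∀ t, 0 ≤ t → ‖expSeries c t‖ ≤ K * Real.exp (-ε * t) := by
  obtain ⟨ε, hε, h⟩ := exists_forall_re_lt_neg hroots
  obtain ⟨K, hK⟩ := exists_norm_expSeries_le_exp_of_prod_X_sub_C h
    (aeval_shiftEnd_prod_roots hq (IsAlgClosed.splits q) hc)
  exact ⟨K, ε, hε, hK⟩

end Recurrence

/-! ### The expansion at infinity and the relative degree -/

section Expansion

/-- The expansion at infinity of a polynomial in `s`, a Laurent series in `1 / s`. -/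
abbrev polyAtInfinity (q : Polynomial ℝ) : LaurentSeries ℝ :=
  q.eval₂ (HahnSeries.C : ℝ →+* LaurentSeries ℝ) (HahnSeries.single (-1 : ℤ) (1 : ℝ))

theorem coeff_polyAtInfinity_mul (q : Polynomial ℝ) (F : LaurentSeries ℝ) (k : ℤ) :
    (polyAtInfinity q * F).coeff k = q.sum fun i a => a * F.coeff (k + i) := by
  rw [polyAtInfinity, Polynomial.eval₂_eq_sum, Polynomial.sum, Finset.sum_mul, Polynomial.sum,
    HahnSeries.coeff_sum]
  refine Finset.sum_congr rfl fun i _ => ?_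
  rw [HahnSeries.single_pow, HahnSeries.C_apply, HahnSeries.single_mul_single,
    HahnSeries.coeff_single_mul]
  simp

theorem coeff_polyAtInfinity (q : Polynomial ℝ) (k : ℤ) :
    (polyAtInfinity q).coeff k = if k ≤ 0 then q.coeff k.natAbs else 0 := by
  have h := coeff_polyAtInfinity_mul q 1 k
  rw [mul_one] at h
  rw [h, Polynomial.sum_def]
  split_ifs with hk
  · rw [Finset.sum_eq_single k.natAbs]
    · rw [HahnSeries.coeff_one, if_pos (by omega), mul_one]
    · intro i _ hi
      rw [HahnSeries.coeff_one, if_neg (by omega), mul_zero]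
    · intro hi
      rw [Polynomial.notMem_support_iff.1 hi, zero_mul]
  · refine Finset.sum_eq_zero fun i _ => ?_
    rw [HahnSeries.coeff_one, if_neg (by omega), mul_zero]

theorem orderTop_polyAtInfinity {q : Polynomial ℝ} (hq : q ≠ 0) :
    (polyAtInfinity q).orderTop = ((-q.natDegree : ℤ) : WithTop ℤ) := by
  refine HahnSeries.orderTop_eq_of_le ?_ fun k hk => ?_
  · simp [coeff_polyAtInfinity, hq]
  · rw [HahnSeries.mem_support, coeff_polyAtInfinity] at hk
    split_ifs at hk
    · have := Polynomial.le_natDegree_of_ne_zero hk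
      omega
    · exact absurd rfl hk

theorem polyAtInfinity_ne_zero {q : Polynomial ℝ} (hq : q ≠ 0) : polyAtInfinity q ≠ 0 := by
  rw [← HahnSeries.orderTop_ne_top, orderTop_polyAtInfinity hq]
  exact WithTop.coe_ne_top

/-- `expansionAtInfinity` as an embedding of `ℝ(s)` into the field of Laurent series in `1 / s`. -/
def expansionHom : RatFunc ℝ →+* LaurentSeries ℝ where
  toFun := expansionAtInfinity
  map_one' := RatFunc.eval_one _ _
  map_mul' g h := RatFunc.eval_mul _ _ (polyAtInfinity_ne_zero g.denom_ne_zero)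
    (polyAtInfinity_ne_zero h.denom_ne_zero)
  map_zero' := RatFunc.eval_zero _ _
  map_add' g h := RatFunc.eval_add _ _ (polyAtInfinity_ne_zero g.denom_ne_zero)
    (polyAtInfinity_ne_zero h.denom_ne_zero)

theorem expansionHom_apply (g : RatFunc ℝ) : expansionHom g = expansionAtInfinity g := rfl

theorem expansionHom_X : expansionHom RatFunc.X = HahnSeries.single (-1 : ℤ) (1 : ℝ) :=
  RatFunc.eval_X _ _

theorem coeff_expansionHom_X_mul (g : RatFunc ℝ) (k : ℤ) :
    (expansionHom (RatFunc.X * g)).coeff k = (expansionHom g).coeff (k + 1) := by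
  rw [map_mul, expansionHom_X, HahnSeries.coeff_single_mul, one_mul, sub_neg_eq_add]

theorem coeff_expansionHom_smul (a : ℝ) (g : RatFunc ℝ) (k : ℤ) :
    (expansionHom (a • g)).coeff k = a * (expansionHom g).coeff k := by
  have hC : expansionHom (RatFunc.C a) = HahnSeries.C a := RatFunc.eval_C _ _
  rw [RatFunc.smul_eq_C_mul, map_mul, hC, HahnSeries.C_apply, HahnSeries.coeff_single_mul, sub_zero]

theorem polyAtInfinity_denom_mul (g : RatFunc ℝ) :
    polyAtInfinity g.denom * expansionHom g = polyAtInfinity g.num :=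
  mul_div_cancel₀ _ (polyAtInfinity_ne_zero g.denom_ne_zero)

/-- The relative degree `deg (denominator) - deg (numerator)` of a rational function, with value
`⊤` at `0`, as an additive valuation. -/
def relativeDegree : AddValuation (RatFunc ℝ) (WithTop ℤ) :=
  (HahnSeries.addVal ℤ ℝ).comap expansionHom

theorem relativeDegree_apply (g : RatFunc ℝ) :
    relativeDegree g = (expansionHom g).orderTop := rfl

theorem relativeDegree_of_ne_zero {g : RatFunc ℝ} (hg : g ≠ 0) :
    relativeDegree g = ((g.denom.natDegree - g.num.natDegree : ℤ) : WithTop ℤ) := by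
  have h := congrArg HahnSeries.orderTop (polyAtInfinity_denom_mul g)
  rw [HahnSeries.orderTop_mul, orderTop_polyAtInfinity g.denom_ne_zero,
    orderTop_polyAtInfinity (RatFunc.num_ne_zero hg), ← relativeDegree_apply] at h
  have htop : relativeDegree g ≠ ⊤ := (AddValuation.ne_top_iff _).2 hg
  obtain ⟨d, hd⟩ := WithTop.ne_top_iff_exists.1 htop
  rw [← hd, ← WithTop.coe_add, WithTop.coe_inj] at h
  rw [← hd, WithTop.coe_inj]
  omega

theorem one_le_relativeDegree_iff (g : RatFunc ℝ) :
    1 ≤ relativeDegree g ↔ g.num.degree < g.denom.degree := by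
  rcases eq_or_ne g 0 with rfl | hg
  · simp
  · rw [relativeDegree_of_ne_zero hg, Polynomial.degree_eq_natDegree (RatFunc.num_ne_zero hg),
      Polynomial.degree_eq_natDegree g.denom_ne_zero, ← WithTop.coe_one, WithTop.coe_le_coe,
      Nat.cast_lt]
    omega

theorem relativeDegree_X : relativeDegree RatFunc.X = ((-1 : ℤ) : WithTop ℤ) := by
  rw [relativeDegree_apply, expansionHom_X, HahnSeries.orderTop_single one_ne_zero]

theorem zero_le_relativeDegree_C (a : ℝ) : 0 ≤ relativeDegree (RatFunc.C a) := by
  rcases eq_or_ne a 0 with rfl | ha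
  · simp
  · rw [relativeDegree_of_ne_zero (by simpa using ha)]
    simp

theorem feedthrough_eq_zero {g : RatFunc ℝ} (hg : 1 ≤ relativeDegree g) : feedthrough g = 0 :=
  HahnSeries.coeff_eq_zero_of_lt_orderTop (zero_lt_one.trans_le hg)

theorem feedthrough_add (g h : RatFunc ℝ) :
    feedthrough (g + h) = feedthrough g + feedthrough h := by
  simp only [feedthrough, ← expansionHom_apply, map_add, HahnSeries.coeff_add]

theorem feedthrough_smul (a : ℝ) (g : RatFunc ℝ) : feedthrough (a • g) = a * feedthrough g := by
  simp only [feedthrough, ← expansionHom_apply, coeff_expansionHom_smul]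

theorem feedthrough_one : feedthrough 1 = 1 := by
  rw [feedthrough, ← expansionHom_apply, map_one, HahnSeries.coeff_one, if_pos rfl]

end Expansion

/-! ### Impulse responses -/

section ImpulseResponse

/-- The Markov parameters of a rational function: its coefficients at `s ^ (-(k + 1))`. -/
def markovParameter (g : RatFunc ℝ) (k : ℕ) : ℝ := (expansionAtInfinity g).coeff ((k : ℤ) + 1)

theorem markovParameter_add (g h : RatFunc ℝ) (k : ℕ) :
    markovParameter (g + h) k = markovParameter g k + markovParameter h k := by
  simp only [markovParameter, ← expansionHom_apply, map_add, HahnSeries.coeff_add]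

theorem markovParameter_smul (a : ℝ) (g : RatFunc ℝ) (k : ℕ) :
    markovParameter (a • g) k = a • markovParameter g k := by
  simp only [markovParameter, ← expansionHom_apply, coeff_expansionHom_smul, smul_eq_mul]

theorem markovParameter_X_mul (g : RatFunc ℝ) (k : ℕ) :
    markovParameter (RatFunc.X * g) k = markovParameter g (k + 1) := by
  simp only [markovParameter, ← expansionHom_apply, coeff_expansionHom_X_mul, Nat.cast_succ]

theorem impulseResponse_eq_expSeries (g : RatFunc ℝ) :
    impulseResponse g = expSeries (markovParameter g) := by
  ext t
  refine tsum_congr fun k => ?_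
  rw [smul_eq_mul, markovParameter]
  ring

theorem aeval_shiftEnd_denom_markovParameter (g : RatFunc ℝ) :
    Polynomial.aeval (shiftEnd ℝ) g.denom (markovParameter g) = 0 := by
  ext k
  have h : (polyAtInfinity g.denom * expansionHom g).coeff ((k : ℤ) + 1) = 0 := by
    rw [polyAtInfinity_denom_mul, coeff_polyAtInfinity, if_neg (by omega)]
  rw [aeval_shiftEnd_apply, Pi.zero_apply, ← h, coeff_polyAtInfinity_mul]
  refine Finset.sum_congr rfl fun i _ => ?_
  simp only [markovParameter, expansionHom_apply, Nat.cast_add, add_right_comm]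

theorem aeval_shiftEnd_map_ofReal {q : Polynomial ℝ} {c : ℕ → ℝ}
    (hc : Polynomial.aeval (shiftEnd ℝ) q c = 0) :
    Polynomial.aeval (shiftEnd ℂ) (q.map (algebraMap ℝ ℂ)) (fun k => (c k : ℂ)) = 0 := by
  ext k
  have hk := congrArg Complex.ofReal (congrFun hc k)
  rw [aeval_shiftEnd_apply, Polynomial.sum_over_range _ (fun _ => by simp)] at hk ⊢
  simpa using hk

theorem expSeries_ofReal (c : ℕ → ℝ) (t : ℝ) :
    expSeries (fun k => (c k : ℂ)) t = (expSeries c t : ℝ) := by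
  rw [expSeries, expSeries, Complex.ofReal_tsum]
  simp

theorem map_denom_ne_zero (g : RatFunc ℝ) : g.denom.map (algebraMap ℝ ℂ) ≠ 0 :=
  (Polynomial.map_ne_zero_iff (algebraMap ℝ ℂ).injective).2 g.denom_ne_zero

theorem aeval_shiftEnd_map_denom_markovParameter (g : RatFunc ℝ) :
    Polynomial.aeval (shiftEnd ℂ) (g.denom.map (algebraMap ℝ ℂ))
      (fun k => (markovParameter g k : ℂ)) = 0 :=
  aeval_shiftEnd_map_ofReal (aeval_shiftEnd_denom_markovParameter g)

theorem hasGeometricGrowth_markovParameter (g : RatFunc ℝ) :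
    HasGeometricGrowth (markovParameter g) := by
  obtain ⟨K, R, hK, hR, h⟩ := HasGeometricGrowth.of_prod_X_sub_C _ _
    (aeval_shiftEnd_prod_roots (map_denom_ne_zero g) (IsAlgClosed.splits _)
      (aeval_shiftEnd_map_denom_markovParameter g))
  exact ⟨K, R, hK, hR, fun k => by simpa using h k⟩

theorem impulseResponse_add (g h : RatFunc ℝ) (t : ℝ) :
    impulseResponse (g + h) t = impulseResponse g t + impulseResponse h t := by
  simp only [impulseResponse_eq_expSeries]
  rw [← (hasGeometricGrowth_markovParameter g).expSeries_add
    (hasGeometricGrowth_markovParameter h)]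
  simp only [expSeries, markovParameter_add]

theorem impulseResponse_smul (a : ℝ) (g : RatFunc ℝ) (t : ℝ) :
    impulseResponse (a • g) t = a * impulseResponse g t := by
  simp only [impulseResponse_eq_expSeries]
  rw [← smul_eq_mul, ← (hasGeometricGrowth_markovParameter g).expSeries_const_smul]
  simp only [expSeries, markovParameter_smul]

theorem impulseResponse_one (t : ℝ) : impulseResponse 1 t = 0 := by
  have h : markovParameter 1 = 0 := by
    ext k
    rw [markovParameter, ← expansionHom_apply, map_one, HahnSeries.coeff_one, if_neg (by omega),
      Pi.zero_apply]
  simp [impulseResponse_eq_expSeries, expSeries, h]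

theorem hasDerivAt_impulseResponse (g : RatFunc ℝ) (t : ℝ) :
    HasDerivAt (impulseResponse g) (impulseResponse (RatFunc.X * g) t) t := by
  simp only [impulseResponse_eq_expSeries, funext (markovParameter_X_mul g)]
  exact (hasGeometricGrowth_markovParameter g).hasDerivAt_expSeries t

theorem continuous_impulseResponse (g : RatFunc ℝ) : Continuous (impulseResponse g) :=
  continuous_iff_continuousAt.2 fun t => (hasDerivAt_impulseResponse g t).continuousAt

/-- The initial value theorem. -/
theorem impulseResponse_zero (g : RatFunc ℝ) :
    impulseResponse g 0 = feedthrough (RatFunc.X * g) := by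
  rw [impulseResponse_eq_expSeries, (hasGeometricGrowth_markovParameter g).expSeries_zero,
    feedthrough, ← expansionHom_apply, coeff_expansionHom_X_mul, markovParameter,
    expansionHom_apply, Nat.cast_zero]

end ImpulseResponse

/-! ### Stability and properness -/

section Stability

/-- The algebra of stable rational functions: those with all poles in the open left half-plane. -/
def stableAlgebra : Subalgebra ℝ (RatFunc ℝ) where
  carrier := {g | ∀ z : ℂ, Polynomial.aeval z g.denom = 0 → z.re < 0}
  mul_mem' {g h} hg hh z hz := by
    have := zero_dvd_iff.1 (hz ▸ map_dvd (Polynomial.aeval z) (RatFunc.denom_mul_dvd g h))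
    rw [map_mul, mul_eq_zero] at this
    exact this.elim (hg z) (hh z)
  add_mem' {g h} hg hh z hz := by
    have := zero_dvd_iff.1 (hz ▸ map_dvd (Polynomial.aeval z) (RatFunc.denom_add_dvd g h))
    rw [map_mul, mul_eq_zero] at this
    exact this.elim (hg z) (hh z)
  algebraMap_mem' a z hz := by
    simp [RatFunc.algebraMap_eq_C] at hz

theorem algebraMap_div_mem_stableAlgebra {q r : Polynomial ℝ}
    (hr : ∀ z : ℂ, Polynomial.aeval z r = 0 → z.re < 0) :
    algebraMap (Polynomial ℝ) (RatFunc ℝ) q / algebraMap (Polynomial ℝ) (RatFunc ℝ) r ∈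
      stableAlgebra := fun z hz =>
  hr z (zero_dvd_iff.1 (hz ▸ map_dvd (Polynomial.aeval z) (RatFunc.denom_div_dvd q r)))

theorem C_mem_stableAlgebra (a : ℝ) : RatFunc.C a ∈ stableAlgebra := by
  rw [← RatFunc.algebraMap_eq_C]
  exact stableAlgebra.algebraMap_mem a

theorem integrableOn_impulseResponse {g : RatFunc ℝ} (hg : g ∈ stableAlgebra) :
    IntegrableOn (impulseResponse g) (Set.Ioi 0) := by
  obtain ⟨K, ε, hε, h⟩ := exists_norm_expSeries_le_exp_of_recurrence (map_denom_ne_zero g)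
    (fun z hz => hg z (by simpa [map_denom_ne_zero g] using hz))
    (aeval_shiftEnd_map_denom_markovParameter g)
  refine Integrable.mono' ((integrableOn_exp_mul_Ioi (neg_neg_of_pos hε) 0).const_mul K)
    (continuous_impulseResponse g).aestronglyMeasurable ?_
  filter_upwards [ae_restrict_mem measurableSet_Ioi] with t ht
  have := h t (le_of_lt ht)
  rwa [expSeries_ofReal, Complex.norm_real, ← impulseResponse_eq_expSeries] at this

variable {k l q : ℕ}

theorem isStable_const (M : Matrix (Fin k) (Fin l) ℝ) : IsStable (const M) :=
  fun i j => C_mem_stableAlgebra (M i j)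

theorem isStable_one : IsStable (1 : TransferMatrix k k) := fun i j => by
  have h : (1 : TransferMatrix k k) i j ∈ stableAlgebra := by
    rw [Matrix.one_apply]
    split_ifs
    exacts [one_mem _, zero_mem _]
  exact h

theorem IsStable.sub {F G : TransferMatrix k l} (hF : IsStable F) (hG : IsStable G) :
    IsStable (F - G) := fun i j => stableAlgebra.sub_mem (hF i j) (hG i j)

theorem IsStable.smul {F : TransferMatrix k l} {g : RatFunc ℝ} (hg : g ∈ stableAlgebra)
    (hF : IsStable F) : IsStable (g • F) := fun i j => stableAlgebra.mul_mem hg (hF i j)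

theorem IsStable.mul {F : TransferMatrix k l} {G : TransferMatrix l q} (hF : IsStable F)
    (hG : IsStable G) : IsStable (F * G) := fun i j =>
  show ∑ a, F i a * G a j ∈ stableAlgebra from
    stableAlgebra.sum_mem fun a _ => stableAlgebra.mul_mem (hF i a) (hG a j)

/-- Every entry has relative degree at least `d`; properness is the case `d = 0` and strict
properness the case `d = 1`. -/
def RelativeDegreeGE (d : ℤ) (F : TransferMatrix k l) : Prop :=
  ∀ i j, (d : WithTop ℤ) ≤ relativeDegree (F i j)

theorem isStrictlyProper_iff_relativeDegreeGE (F : TransferMatrix k l) :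
    IsStrictlyProper F ↔ RelativeDegreeGE 1 F :=
  forall₂_congr fun i j => (one_le_relativeDegree_iff (F i j)).symm

theorem RelativeDegreeGE.mono {d e : ℤ} {F : TransferMatrix k l} (hF : RelativeDegreeGE d F)
    (hed : e ≤ d) : RelativeDegreeGE e F := fun i j => (WithTop.coe_le_coe.2 hed).trans (hF i j)

theorem relativeDegreeGE_const (M : Matrix (Fin k) (Fin l) ℝ) : RelativeDegreeGE 0 (const M) :=
  fun i j => zero_le_relativeDegree_C (M i j)

theorem relativeDegreeGE_one : RelativeDegreeGE 0 (1 : TransferMatrix k k) := fun i j => by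
  rw [Matrix.one_apply]
  split_ifs <;> simp

theorem RelativeDegreeGE.add {d : ℤ} {F G : TransferMatrix k l} (hF : RelativeDegreeGE d F)
    (hG : RelativeDegreeGE d G) : RelativeDegreeGE d (F + G) :=
  fun i j => relativeDegree.map_le_add (hF i j) (hG i j)

theorem RelativeDegreeGE.sub {d : ℤ} {F G : TransferMatrix k l} (hF : RelativeDegreeGE d F)
    (hG : RelativeDegreeGE d G) : RelativeDegreeGE d (F - G) :=
  fun i j => relativeDegree.map_le_sub (hF i j) (hG i j)

theorem RelativeDegreeGE.C_smul {d : ℤ} {F : TransferMatrix k l} (hF : RelativeDegreeGE d F)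
    (a : ℝ) : RelativeDegreeGE d (RatFunc.C a • F) := fun i j => by
  rw [Matrix.smul_apply, smul_eq_mul, relativeDegree.map_mul]
  exact (hF i j).trans (le_add_of_nonneg_left (zero_le_relativeDegree_C a))

theorem RelativeDegreeGE.mul {d e : ℤ} {F : TransferMatrix k l} {G : TransferMatrix l q}
    (hF : RelativeDegreeGE d F) (hG : RelativeDegreeGE e G) :
    RelativeDegreeGE (d + e) (F * G) := fun i j => by
  rw [Matrix.mul_apply]
  refine relativeDegree.map_le_sum fun a _ => ?_
  rw [relativeDegree.map_mul, WithTop.coe_add]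
  exact add_le_add (hF i a) (hG a j)

theorem IsRightInteractor.isUnit_det {M₀ : TransferMatrix k l} {Z : TransferMatrix l l}
    (h : IsRightInteractor M₀ Z⁻¹) : IsUnit Z.det := by
  by_contra hZ
  obtain ⟨E, hrank, hlim⟩ := h
  rw [Matrix.nonsing_inv_apply_not_isUnit _ hZ, Matrix.mul_zero] at hlim
  have hE : E = 0 := by
    ext i j
    have hij := hlim i j
    simp only [Matrix.zero_apply, RatFunc.eval_zero] at hij
    exact_mod_cast tendsto_nhds_unique hij tendsto_const_nhds
  obtain rfl : 0 = l := by rw [← hrank, hE, Matrix.rank_zero]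
  exact hZ (by simp)

end Stability

section Resolvent

variable {k l q : ℕ} (A : Matrix (Fin k) (Fin k) ℝ)

theorem X_smul_one_sub_const :
    (RatFunc.X : RatFunc ℝ) • (1 : TransferMatrix k k) - const A =
      (algebraMap (Polynomial ℝ) (RatFunc ℝ)).mapMatrix A.charmatrix := by
  ext i j
  by_cases h : i = j <;> simp [const, Matrix.charmatrix, h]

theorem det_X_smul_one_sub_const :
    ((RatFunc.X : RatFunc ℝ) • (1 : TransferMatrix k k) - const A).det =
      algebraMap (Polynomial ℝ) (RatFunc ℝ) A.charpoly := by
  rw [X_smul_one_sub_const, ← RingHom.map_det, Matrix.charpoly]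

theorem X_smul_resolvent :
    (RatFunc.X : RatFunc ℝ) • resolvent A = const A * resolvent A + 1 := by
  have hdet : ((RatFunc.X : RatFunc ℝ) • (1 : TransferMatrix k k) - const A).det ≠ 0 := by
    rw [det_X_smul_one_sub_const]
    exact RatFunc.algebraMap_ne_zero (Matrix.charpoly_monic A).ne_zero
  have h := Matrix.mul_nonsing_inv _ hdet.isUnit
  rw [Matrix.sub_mul, Matrix.smul_mul, Matrix.one_mul] at h
  exact sub_eq_iff_eq_add'.1 h

theorem X_smul_resolvent_mul (B : TransferMatrix k l) :
    (RatFunc.X : RatFunc ℝ) • (resolvent A * B) = const A * (resolvent A * B) + B := by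
  rw [← Matrix.smul_mul, X_smul_resolvent, Matrix.add_mul, Matrix.one_mul, Matrix.mul_assoc]

theorem resolvent_apply (i j : Fin k) :
    resolvent A i j = algebraMap (Polynomial ℝ) (RatFunc ℝ) (A.charmatrix.adjugate i j) /
      algebraMap (Polynomial ℝ) (RatFunc ℝ) A.charpoly := by
  rw [resolvent, Matrix.inv_def, det_X_smul_one_sub_const, Ring.inverse_eq_inv',
    X_smul_one_sub_const, ← RingHom.map_adjugate, Matrix.smul_apply, smul_eq_mul,
    inv_mul_eq_div, RingHom.mapMatrix_apply, Matrix.map_apply]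

variable {A} in
theorem IsHurwitz.isStable_resolvent (hA : IsHurwitz A) : IsStable (resolvent A) := fun i j => by
  rw [resolvent_apply]
  refine algebraMap_div_mem_stableAlgebra fun z hz => hA z ?_
  rwa [Matrix.mem_spectrum_iff_isRoot_charpoly, Matrix.charpoly_map, Polynomial.IsRoot,
    Polynomial.eval_map_algebraMap]

/-- If the least relative degree `d` of the entries were at most `0`, then `s R = A R + 1` would
give `d ≤ d - 1`. -/
theorem relativeDegreeGE_resolvent : RelativeDegreeGE 1 (resolvent A) := by
  intro i₀ j₀
  have : Nonempty (Fin k × Fin k) := ⟨(i₀, j₀)⟩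
  obtain ⟨⟨i, j⟩, hmin⟩ :=
    Finite.exists_min fun e : Fin k × Fin k => relativeDegree (resolvent A e.1 e.2)
  refine le_trans ?_ (hmin (i₀, j₀))
  by_contra! hlt
  obtain ⟨d, hd⟩ := WithTop.ne_top_iff_exists.1 hlt.ne_top
  have hR : RelativeDegreeGE d (resolvent A) := fun a b => hd.trans_le (hmin (a, b))
  simp only [← hd, WithTop.coe_lt_coe] at hlt
  have hX : RelativeDegreeGE d (const A * resolvent A + 1) := by
    have h := (relativeDegreeGE_const A).mul hR
    rw [zero_add] at h
    exact h.add (relativeDegreeGE_one.mono (by omega))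
  have hij := hX i j
  rw [← X_smul_resolvent, Matrix.smul_apply, smul_eq_mul, relativeDegree.map_mul,
    relativeDegree_X, ← hd, ← WithTop.coe_add, WithTop.coe_le_coe] at hij
  omega

end Resolvent

/-! ### Convolution with a bounded signal -/

section Convolution

variable {v k k' : ℝ → ℝ}

theorem intervalIntegrable_mul_of_memLp_top (hv : MemLp v ∞) (hk : Continuous k) (a b : ℝ) :
    IntervalIntegrable (fun s => k s * v s) volume a b := by
  have hki := hk.intervalIntegrable (μ := volume) a b
  rw [intervalIntegrable_iff] at hki ⊢
  exact hki.mul_bdd hv.1.restrict (ae_restrict_of_ae (ae_le_lpNorm_exponent_top hv))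

theorem hasDerivAt_integral_comp_sub_mul (hv : MemLp v ∞) (hk : ∀ t, HasDerivAt k (k' t) t)
    (hk' : Continuous k') (a b t₀ : ℝ) :
    HasDerivAt (fun t => ∫ s in a..b, k (t - s) * v s) (∫ s in a..b, k' (t₀ - s) * v s) t₀ := by
  have hkc : Continuous k := continuous_iff_continuousAt.2 fun t => (hk t).continuousAt
  obtain ⟨K, hK⟩ := ((isCompact_closedBall t₀ 1).prod (isCompact_uIcc (a := a) (b := b))).image
    continuous_sub |>.exists_bound_of_continuousOn hk'.continuousOn
  refine (intervalIntegral.hasDerivAt_integral_of_dominated_loc_of_deriv_le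
    (F := fun t s => k (t - s) * v s) (F' := fun t s => k' (t - s) * v s)
    (bound := fun _ => K * lpNorm v ∞ volume) (Metric.ball_mem_nhds t₀ one_pos)
    (Eventually.of_forall fun t => ?_) ?_ ?_ ?_ intervalIntegrable_const ?_).2
  · exact ((hkc.comp (continuous_sub_left t)).aestronglyMeasurable.mul hv.1).restrict
  · exact intervalIntegrable_mul_of_memLp_top hv (hkc.comp (continuous_sub_left t₀)) a b
  · exact ((hk'.comp (continuous_sub_left t₀)).aestronglyMeasurable.mul hv.1).restrict
  · filter_upwards [ae_le_lpNorm_exponent_top hv] with s hs hsab t ht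
    have hts := hK (t - s) ⟨(t, s), ⟨Metric.ball_subset_closedBall ht, Set.uIoc_subset_uIcc hsab⟩,
      rfl⟩
    rw [norm_mul]
    exact mul_le_mul hts hs (norm_nonneg _) ((norm_nonneg _).trans hts)
  · exact Eventually.of_forall fun s _ t _ => ((hk (t - s)).comp_sub_const t s).mul_const (v s)

theorem hasDerivAt_integral_comp_sub_mul_right_of_zero (hv : MemLp v ∞) (hk : ContinuousAt k 0)
    (hk0 : k 0 = 0) (t₀ : ℝ) : HasDerivAt (fun t => ∫ s in t₀..t, k (t - s) * v s) 0 t₀ := by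
  rw [hasDerivAt_iff_isLittleO, Asymptotics.isLittleO_iff]
  intro ε hε
  set V := lpNorm v ∞ volume
  have hV : 0 < V + 1 := add_pos_of_nonneg_of_pos lpNorm_nonneg one_pos
  obtain ⟨δ, hδ, hkδ⟩ := Metric.continuousAt_iff.1 hk (ε / (V + 1)) (by positivity)
  filter_upwards [Metric.ball_mem_nhds t₀ hδ] with t ht
  have hbound : ∀ᵐ s, s ∈ Set.uIoc t₀ t → ‖k (t - s) * v s‖ ≤ ε := by
    filter_upwards [ae_le_lpNorm_exponent_top hv] with s hs hst
    have hts : dist (t - s) 0 < δ := by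
      rw [dist_zero_right, Real.norm_eq_abs]
      exact (Set.abs_sub_right_of_mem_uIcc (Set.uIoc_subset_uIcc hst)).trans_lt ht
    have hks := (hkδ hts).le
    rw [hk0, dist_zero_right] at hks
    calc ‖k (t - s) * v s‖ = ‖k (t - s)‖ * ‖v s‖ := norm_mul _ _
      _ ≤ ε / (V + 1) * (V + 1) := by gcongr; linarith
      _ = ε := div_mul_cancel₀ _ hV.ne'
  simpa using intervalIntegral.norm_integral_le_of_norm_le_const_ae hbound

theorem hasDerivAt_convolution_of_zero (hv : MemLp v ∞) (hk : ∀ t, HasDerivAt k (k' t) t)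
    (hk' : Continuous k') (hk0 : k 0 = 0) (t₀ : ℝ) :
    HasDerivAt (fun t => ∫ s in (0 : ℝ)..t, k (t - s) * v s)
      (∫ s in (0 : ℝ)..t₀, k' (t₀ - s) * v s) t₀ := by
  have hkc : Continuous k := continuous_iff_continuousAt.2 fun t => (hk t).continuousAt
  have h := (hasDerivAt_integral_comp_sub_mul hv hk hk' 0 t₀ t₀).add
    (hasDerivAt_integral_comp_sub_mul_right_of_zero hv hkc.continuousAt hk0 t₀)
  rw [add_zero] at h
  refine h.congr_of_eventuallyEq (Eventually.of_forall fun t => ?_)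
  have hi := intervalIntegrable_mul_of_memLp_top hv (hkc.comp (continuous_sub_left t))
  exact (intervalIntegral.integral_add_adjacent_intervals (hi 0 t₀) (hi t₀ t)).symm

theorem hasDerivAt_convolution_of_continuous (hv : MemLp v ∞) (hvc : Continuous v)
    (hk : ∀ t, HasDerivAt k (k' t) t) (hk' : Continuous k') (t₀ : ℝ) :
    HasDerivAt (fun t => ∫ s in (0 : ℝ)..t, k (t - s) * v s)
      (k 0 * v t₀ + ∫ s in (0 : ℝ)..t₀, k' (t₀ - s) * v s) t₀ := by
  have hkc : Continuous k := continuous_iff_continuousAt.2 fun t => (hk t).continuousAt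
  have hconst := ((hvc.integral_hasStrictDerivAt 0 t₀).hasDerivAt).const_mul (k 0)
  have hzero := hasDerivAt_convolution_of_zero hv (k := fun t => k t - k 0)
    (fun t => (hk t).sub_const _) hk' (sub_self _) t₀
  refine (hconst.add hzero).congr_of_eventuallyEq (Eventually.of_forall fun t => ?_)
  have hi₁ := (hvc.intervalIntegrable (μ := volume) 0 t).const_mul (k 0)
  have hi₂ : IntervalIntegrable (fun s => (k (t - s) - k 0) * v s) volume 0 t :=
    intervalIntegrable_mul_of_memLp_top hv
      ((hkc.comp (continuous_sub_left t)).sub continuous_const) 0 t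
  simp only [Pi.add_apply]
  rw [← intervalIntegral.integral_const_mul, ← intervalIntegral.integral_add hi₁ hi₂]
  refine intervalIntegral.integral_congr fun s _ => ?_
  ring

end Convolution

/-! ### The zero-state response -/

section EntryResponse

/-- The zero-state response of a proper scalar transfer function; `response` is the sum of these
over the entries of a row. -/
def entryResponse (g : RatFunc ℝ) (v : ℝ → ℝ) (t : ℝ) : ℝ :=
  feedthrough g * v t + ∫ s in (0 : ℝ)..t, impulseResponse g (t - s) * v s

variable {v w : ℝ → ℝ}

theorem intervalIntegrable_impulseResponse_mul (hv : MemLp v ∞) (g : RatFunc ℝ) (t : ℝ) :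
    IntervalIntegrable (fun s => impulseResponse g (t - s) * v s) volume 0 t :=
  intervalIntegrable_mul_of_memLp_top hv
    ((continuous_impulseResponse g).comp (continuous_sub_left t)) 0 t

theorem isLinearMap_entryResponse (hv : MemLp v ∞) (t : ℝ) :
    IsLinearMap ℝ fun g => entryResponse g v t where
  map_add g h := by
    simp only [entryResponse, feedthrough_add, impulseResponse_add, add_mul]
    rw [intervalIntegral.integral_add (intervalIntegrable_impulseResponse_mul hv g t)
      (intervalIntegrable_impulseResponse_mul hv h t)]
    ring
  map_smul a g := by
    simp only [entryResponse, feedthrough_smul, impulseResponse_smul, mul_assoc, smul_eq_mul]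
    rw [intervalIntegral.integral_const_mul]
    ring

theorem entryResponse_sum_smul (hv : MemLp v ∞) {ι : Type*} (s : Finset ι) (a : ι → ℝ)
    (g : ι → RatFunc ℝ) (t : ℝ) :
    entryResponse (∑ i ∈ s, a i • g i) v t = ∑ i ∈ s, a i * entryResponse (g i) v t := by
  have h := map_sum ((isLinearMap_entryResponse hv t).mk' _) (fun i => a i • g i) s
  simpa only [map_smul, IsLinearMap.mk'_apply, smul_eq_mul] using h

theorem entryResponse_sub_right (g : RatFunc ℝ) (hv : MemLp v ∞) (hw : MemLp w ∞) (t : ℝ) :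
    entryResponse g (fun s => v s - w s) t = entryResponse g v t - entryResponse g w t := by
  simp only [entryResponse, mul_sub]
  rw [intervalIntegral.integral_sub (intervalIntegrable_impulseResponse_mul hv g t)
    (intervalIntegrable_impulseResponse_mul hw g t)]
  ring

theorem entryResponse_sum_mul_right (g : RatFunc ℝ) {ι : Type*} (s : Finset ι) (a : ι → ℝ)
    {v : ι → ℝ → ℝ} (hv : ∀ i, MemLp (v i) ∞) (t : ℝ) :
    entryResponse g (fun y => ∑ i ∈ s, a i * v i y) t = ∑ i ∈ s, a i * entryResponse g (v i) t := by
  simp only [entryResponse, Finset.mul_sum, mul_add, Finset.sum_add_distrib, mul_left_comm _ (a _)]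
  rw [intervalIntegral.integral_finsetSum fun i _ =>
    (intervalIntegrable_impulseResponse_mul (hv i) g t).const_mul (a i)]
  simp only [intervalIntegral.integral_const_mul]

theorem entryResponse_one (v : ℝ → ℝ) (t : ℝ) : entryResponse 1 v t = v t := by
  simp only [entryResponse, feedthrough_one, impulseResponse_one, zero_mul, one_mul,
    intervalIntegral.integral_zero, add_zero]

theorem entryResponse_congr (g : RatFunc ℝ) {t : ℝ} (ht : 0 ≤ t)
    (h : Set.EqOn v w (Set.Icc 0 t)) : entryResponse g v t = entryResponse g w t := by
  have hint : Set.EqOn (fun s => impulseResponse g (t - s) * v s)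
      (fun s => impulseResponse g (t - s) * w s) (Set.uIcc 0 t) := fun s hs => by
    simp only [h (Set.uIcc_of_le ht ▸ hs)]
  rw [entryResponse, entryResponse, h (Set.right_mem_Icc.2 ht),
    intervalIntegral.integral_congr hint]

theorem entryResponse_apply_zero {g : RatFunc ℝ} (hg : 1 ≤ relativeDegree g) (v : ℝ → ℝ) :
    entryResponse g v 0 = 0 := by
  rw [entryResponse, feedthrough_eq_zero hg, zero_mul, intervalIntegral.integral_same, add_zero]

theorem hasDerivAt_entryResponse (hv : MemLp v ∞) {g : RatFunc ℝ} (hg : 1 ≤ relativeDegree g)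
    (h : 1 ≤ relativeDegree (RatFunc.X * g) ∨ Continuous v) (t : ℝ) :
    HasDerivAt (entryResponse g v) (entryResponse (RatFunc.X * g) v t) t := by
  have hconv : entryResponse g v =
      fun t => ∫ s in (0 : ℝ)..t, impulseResponse g (t - s) * v s := by
    ext t
    rw [entryResponse, feedthrough_eq_zero hg, zero_mul, zero_add]
  rw [hconv, entryResponse]
  rcases h with hX | hvc
  · have hzero := (impulseResponse_zero g).trans (feedthrough_eq_zero hX)
    rw [feedthrough_eq_zero hX, zero_mul, zero_add]
    exact hasDerivAt_convolution_of_zero hv (hasDerivAt_impulseResponse g)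
      (continuous_impulseResponse _) hzero t
  · rw [← impulseResponse_zero]
    exact hasDerivAt_convolution_of_continuous hv hvc (hasDerivAt_impulseResponse g)
      (continuous_impulseResponse _) t

theorem integral_abs_impulseResponse_le {g : RatFunc ℝ} (hg : g ∈ stableAlgebra) {t : ℝ}
    (ht : 0 ≤ t) :
    ∫ s in (0 : ℝ)..t, |impulseResponse g (t - s)| ≤
      ∫ s in Set.Ioi (0 : ℝ), |impulseResponse g s| := by
  rw [intervalIntegral.integral_comp_sub_left (fun s => |impulseResponse g s|), sub_self, sub_zero,
    intervalIntegral.integral_of_le ht]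
  exact setIntegral_mono_set (integrableOn_impulseResponse hg).abs
    (Eventually.of_forall fun _ => abs_nonneg _) Set.Ioc_subset_Ioi_self.eventuallyLE

theorem abs_entryResponse_le {g : RatFunc ℝ} (hg : 1 ≤ relativeDegree g) (hs : g ∈ stableAlgebra)
    {V t : ℝ} (hV : 0 ≤ V) (ht : 0 ≤ t) (hv : ∀ᵐ s, s ∈ Set.Icc 0 t → |v s| ≤ V) :
    |entryResponse g v t| ≤ l1NormEntry g * V := by
  rw [entryResponse, l1NormEntry, feedthrough_eq_zero hg, zero_mul, zero_add, abs_zero, zero_add]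
  have hc : Continuous fun s => |impulseResponse g (t - s)| * V :=
    ((continuous_impulseResponse g).comp (continuous_sub_left t)).abs.mul continuous_const
  calc |∫ s in (0 : ℝ)..t, impulseResponse g (t - s) * v s|
      ≤ ∫ s in (0 : ℝ)..t, |impulseResponse g (t - s)| * V := by
        rw [← Real.norm_eq_abs]
        refine intervalIntegral.norm_integral_le_of_norm_le ht (hv.mono fun s hs hst => ?_)
          (hc.intervalIntegrable 0 t)
        rw [norm_mul]
        exact mul_le_mul_of_nonneg_left (hs ⟨hst.1.le, hst.2⟩) (norm_nonneg _)
    _ = (∫ s in (0 : ℝ)..t, |impulseResponse g (t - s)|) * V :=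
        intervalIntegral.integral_mul_const _ _
    _ ≤ (∫ s in Set.Ioi (0 : ℝ), |impulseResponse g s|) * V :=
        mul_le_mul_of_nonneg_right (integral_abs_impulseResponse_le hs ht) hV

end EntryResponse

section Response

variable {k l q : ℕ}

theorem response_apply (F : TransferMatrix k l) (v : ℝ → Fin l → ℝ) (t : ℝ) (i : Fin k) :
    response F v t i = ∑ j, entryResponse (F i j) (fun s => v s j) t := rfl

theorem response_sub_left {v : ℝ → Fin l → ℝ} (hv : MemLp v ∞) (F G : TransferMatrix k l)
    (t : ℝ) : response (F - G) v t = response F v t - response G v t := by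
  ext i
  simp only [Pi.sub_apply, response_apply, ← Finset.sum_sub_distrib, Matrix.sub_apply]
  exact Finset.sum_congr rfl fun j _ => (isLinearMap_entryResponse (hv.eval j) t).map_sub _ _

theorem response_add_left {v : ℝ → Fin l → ℝ} (hv : MemLp v ∞) (F G : TransferMatrix k l)
    (t : ℝ) : response (F + G) v t = response F v t + response G v t := by
  ext i
  simp only [Pi.add_apply, response_apply, ← Finset.sum_add_distrib, Matrix.add_apply]
  exact Finset.sum_congr rfl fun j _ => (isLinearMap_entryResponse (hv.eval j) t).map_add _ _

theorem response_const_mul {v : ℝ → Fin q → ℝ} (hv : MemLp v ∞) (M : Matrix (Fin k) (Fin l) ℝ)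
    (F : TransferMatrix l q) (t : ℝ) : response (const M * F) v t = M *ᵥ response F v t := by
  ext i
  simp only [response_apply, Matrix.mulVec, dotProduct, Finset.mul_sum]
  rw [Finset.sum_comm]
  refine Finset.sum_congr rfl fun j _ => ?_
  rw [← entryResponse_sum_smul (hv.eval j)]
  simp only [Matrix.mul_apply, const, Matrix.map_apply, RatFunc.smul_eq_C_mul]

theorem response_mul_const {v : ℝ → Fin q → ℝ} (hv : MemLp v ∞) (F : TransferMatrix k l)
    (M : Matrix (Fin l) (Fin q) ℝ) (t : ℝ) :
    response (F * const M) v t = response F (fun s => M *ᵥ v s) t := by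
  ext i
  simp only [response_apply, Matrix.mulVec, dotProduct]
  simp_rw [entryResponse_sum_mul_right _ _ _ fun j => hv.eval j]
  rw [Finset.sum_comm]
  refine Finset.sum_congr rfl fun j _ => ?_
  rw [← entryResponse_sum_smul (hv.eval j)]
  simp only [Matrix.mul_apply, const, Matrix.map_apply, RatFunc.smul_eq_C_mul, mul_comm]

theorem response_sub_right (F : TransferMatrix k l) {v w : ℝ → Fin l → ℝ} (hv : MemLp v ∞)
    (hw : MemLp w ∞) (t : ℝ) :
    response F (fun s => v s - w s) t = response F v t - response F w t := by
  ext i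
  simp only [Pi.sub_apply, response_apply, ← Finset.sum_sub_distrib]
  exact Finset.sum_congr rfl fun j _ => entryResponse_sub_right _ (hv.eval j) (hw.eval j) t

theorem response_one {v : ℝ → Fin k → ℝ} (hv : MemLp v ∞) (t : ℝ) : response 1 v t = v t := by
  ext i
  rw [response_apply, Finset.sum_eq_single i, Matrix.one_apply_eq, entryResponse_one]
  · intro j _ hj
    rw [Matrix.one_apply_ne hj.symm]
    exact (isLinearMap_entryResponse (hv.eval j) t).map_zero
  · exact fun hi => absurd (Finset.mem_univ i) hi

theorem response_C_smul_left {v : ℝ → Fin l → ℝ} (hv : MemLp v ∞) (a : ℝ)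
    (F : TransferMatrix k l) (t : ℝ) : response (RatFunc.C a • F) v t = a • response F v t := by
  ext i
  simp only [response_apply, Pi.smul_apply, Finset.smul_sum]
  refine Finset.sum_congr rfl fun j _ => ?_
  rw [Matrix.smul_apply, smul_eq_mul, ← RatFunc.smul_eq_C_mul]
  exact (isLinearMap_entryResponse (hv.eval j) t).map_smul a (F i j)

theorem response_congr (F : TransferMatrix k l) {v w : ℝ → Fin l → ℝ} {t : ℝ} (ht : 0 ≤ t)
    (h : Set.EqOn v w (Set.Icc 0 t)) : response F v t = response F w t := by
  ext i
  exact Finset.sum_congr rfl fun j _ =>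
    entryResponse_congr (F i j) ht fun s hs => congrFun (h hs) j

theorem response_apply_zero {F : TransferMatrix k l} (hF : RelativeDegreeGE 1 F)
    (v : ℝ → Fin l → ℝ) : response F v 0 = 0 := by
  ext i
  exact Finset.sum_eq_zero fun j _ => entryResponse_apply_zero (hF i j) fun s => v s j

theorem hasDerivAt_response {v : ℝ → Fin l → ℝ} (hv : MemLp v ∞) {F : TransferMatrix k l}
    (hF : RelativeDegreeGE 1 F)
    (h : RelativeDegreeGE 1 ((RatFunc.X : RatFunc ℝ) • F) ∨ Continuous v) (t : ℝ) :
    HasDerivAt (response F v) (response ((RatFunc.X : RatFunc ℝ) • F) v t) t :=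
  hasDerivAt_pi.2 fun i => HasDerivAt.fun_sum fun j _ =>
    hasDerivAt_entryResponse (hv.eval j) (hF i j)
      (h.imp (fun hX => hX i j) fun hvc => (continuous_apply j).comp hvc) t

theorem l1NormEntry_nonneg (g : RatFunc ℝ) : 0 ≤ l1NormEntry g :=
  add_nonneg (abs_nonneg _) (integral_nonneg fun _ => abs_nonneg _)

theorem l1Norm_nonneg (F : TransferMatrix k l) : 0 ≤ l1Norm F :=
  Real.iSup_nonneg fun _ => Finset.sum_nonneg fun _ _ => l1NormEntry_nonneg _

theorem norm_response_le {F : TransferMatrix k l} (hF : RelativeDegreeGE 1 F) (hs : IsStable F)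
    {v : ℝ → Fin l → ℝ} {V t : ℝ} (hV : 0 ≤ V) (ht : 0 ≤ t)
    (hv : ∀ᵐ s, s ∈ Set.Icc 0 t → ‖v s‖ ≤ V) : ‖response F v t‖ ≤ l1Norm F * V := by
  refine (pi_norm_le_iff_of_nonneg (mul_nonneg (l1Norm_nonneg F) hV)).2 fun i => ?_
  calc ‖response F v t i‖ ≤ ∑ j, |entryResponse (F i j) (fun s => v s j) t| :=
        Finset.abs_sum_le_sum_abs _ _
    _ ≤ ∑ j, l1NormEntry (F i j) * V :=
        Finset.sum_le_sum fun j _ => abs_entryResponse_le (hF i j) (hs i j) hV ht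
          (hv.mono fun s h hst => (norm_le_pi_norm (v s) j).trans (h hst))
    _ = (∑ j, l1NormEntry (F i j)) * V := by rw [Finset.sum_mul]
    _ ≤ l1Norm F * V := mul_le_mul_of_nonneg_right
        (le_ciSup (f := fun i => ∑ j, l1NormEntry (F i j)) (Set.finite_range _).bddAbove i) hV

theorem hasDerivAt_response_resolvent_mul (A : Matrix (Fin k) (Fin k) ℝ)
    (B : Matrix (Fin k) (Fin l) ℝ) {W : TransferMatrix l q} {v : ℝ → Fin q → ℝ} (hv : MemLp v ∞)
    (hW : RelativeDegreeGE 0 W) (h : RelativeDegreeGE 1 W ∨ Continuous v) (t : ℝ) :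
    HasDerivAt (response (resolvent A * const B * W) v)
      (A *ᵥ response (resolvent A * const B * W) v t + B *ᵥ response W v t) t := by
  set F := resolvent A * const B * W with hFdef
  have hXF : (RatFunc.X : RatFunc ℝ) • F = const A * F + const B * W := by
    rw [hFdef, Matrix.mul_assoc, X_smul_resolvent_mul]
  have hF : RelativeDegreeGE 1 F := by
    simpa using ((relativeDegreeGE_resolvent A).mul (relativeDegreeGE_const B)).mul hW
  have hXF₁ (hW₁ : RelativeDegreeGE 1 W) : RelativeDegreeGE 1 ((RatFunc.X : RatFunc ℝ) • F) := by
    rw [hXF]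
    have hAF := (relativeDegreeGE_const A).mul hF
    have hBW := (relativeDegreeGE_const B).mul hW₁
    rw [zero_add] at hAF hBW
    exact hAF.add hBW
  refine (hasDerivAt_response hv hF (h.imp_left hXF₁) t).congr_deriv ?_
  rw [hXF, response_add_left hv, response_const_mul hv, response_const_mul hv]

end Response

/-! ### Signals on a compact interval and the small-gain argument -/

section Signals

theorem ae_norm_indicator_le_toReal_eLpNorm {α E : Type*} [MeasurableSpace α] {μ : Measure α}
    [NormedAddCommGroup E] {s : Set α} (hs : MeasurableSet s) {v : α → E}
    (hv : MemLp v ∞ (μ.restrict s)) :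
    ∀ᵐ t ∂μ, ‖s.indicator v t‖ ≤ (eLpNorm v ∞ (μ.restrict s)).toReal := by
  have hind := (memLp_indicator_iff_restrict hs).2 hv
  filter_upwards [ae_le_lpNorm_exponent_top hind] with t ht
  rwa [← toReal_eLpNorm hind.1, eLpNorm_indicator_eq_eLpNorm_restrict hs] at ht

theorem memLp_top_mulVec {α : Type*} [MeasurableSpace α] {μ : Measure α} {k l : ℕ}
    (M : Matrix (Fin k) (Fin l) ℝ) {v : α → Fin l → ℝ} (hv : MemLp v ∞ μ) :
    MemLp (fun s => M *ᵥ v s) ∞ μ :=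
  (Matrix.mulVecLin M).toContinuousLinearMap.comp_memLp' hv

theorem exists_continuous_memLp_top_eqOn_Icc {E : Type*} [NormedAddCommGroup E] [NormedSpace ℝ E]
    {g : ℝ → E} {a b : ℝ} (hab : a ≤ b) (hg : ContinuousOn g (Set.Icc a b)) :
    ∃ η : ℝ → E, Continuous η ∧ MemLp η ∞ ∧ Set.EqOn η g (Set.Icc a b) := by
  have hη := hg.domRestrict.Icc_extend' (h := hab)
  obtain ⟨V, hV⟩ := isCompact_Icc.exists_bound_of_continuousOn hg
  exact ⟨_, hη, memLp_top_of_bound hη.aestronglyMeasurable V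
    (Eventually.of_forall fun s => hV _ (Set.projIcc a b hab s).2),
    fun t ht => Set.IccExtend_of_mem hab _ ht⟩

theorem truncNorm_le_ofReal {k : ℕ} {τ c : ℝ} {x : ℝ → Fin k → ℝ}
    (h : ∀ t ∈ Set.Icc 0 τ, ‖x t‖ ≤ c) : truncNorm τ x ≤ ENNReal.ofReal c := by
  rw [truncNorm, eLpNorm_exponent_top]
  exact eLpNormEssSup_le_of_ae_bound ((ae_restrict_mem measurableSet_Icc).mono h)

theorem eqOn_Icc_of_hasDerivWithinAt_mulVec_add {k : ℕ} {A : Matrix (Fin k) (Fin k) ℝ} {a b : ℝ}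
    {w x y : ℝ → Fin k → ℝ}
    (hx : ∀ t ∈ Set.Icc a b, HasDerivWithinAt x (A *ᵥ x t + w t) (Set.Icc a b) t)
    (hy : ∀ t ∈ Set.Icc a b, HasDerivWithinAt y (A *ᵥ y t + w t) (Set.Icc a b) t)
    (h : x a = y a) : Set.EqOn x y (Set.Icc a b) := by
  have hlip (t : ℝ) : LipschitzWith ‖(Matrix.mulVecLin A).toContinuousLinearMap‖₊
      fun z => A *ᵥ z + w t := LipschitzWith.of_dist_le_mul fun z₁ z₂ => by
    rw [dist_add_right]
    exact (Matrix.mulVecLin A).toContinuousLinearMap.lipschitz.dist_le_mul z₁ z₂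
  have hIci {z : ℝ → Fin k → ℝ} {z' : Fin k → ℝ} {t : ℝ} (ht : t ∈ Set.Ico a b)
      (hz : HasDerivWithinAt z z' (Set.Icc a b) t) : HasDerivWithinAt z z' (Set.Ici t) t :=
    hz.mono_of_mem_nhdsWithin (Icc_mem_nhdsGE_of_mem ht)
  exact ODE_solution_unique (v := fun t z => A *ᵥ z + w t) hlip
    (fun t ht => (hx t ht).continuousWithinAt)
    (fun t ht => hIci ht (hx t (Set.Ico_subset_Icc_self ht)))
    (fun t ht => (hy t ht).continuousWithinAt)
    (fun t ht => hIci ht (hy t (Set.Ico_subset_Icc_self ht))) h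

end Signals

section SmallGain

variable {φ : ℝ → ℝ} {a g ρ τ : ℝ}

theorem forall_le_of_forall_le_imp_lt (hφ : ContinuousOn φ (Set.Icc 0 τ)) (h₀ : φ 0 < ρ)
    (hstep : ∀ t ∈ Set.Icc 0 τ, (∀ s ∈ Set.Icc 0 t, φ s ≤ ρ) → φ t < ρ) :
    ∀ t ∈ Set.Icc 0 τ, φ t ≤ ρ := by
  by_contra! hcon
  have hclosed : IsClosed (Set.Icc 0 τ ∩ φ ⁻¹' Set.Ici ρ) :=
    hφ.preimage_isClosed_of_isClosed isClosed_Icc isClosed_Ici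
  obtain ⟨t, ⟨ht, hρt⟩, hmin⟩ := (isCompact_Icc.of_isClosed_subset hclosed
    Set.inter_subset_left).exists_isLeast (hcon.imp fun t h => ⟨h.1, h.2.le⟩)
  have ht₀ : 0 ≠ t := fun h => absurd hρt (not_le.2 (h ▸ h₀))
  have hbefore : ∀ s ∈ Set.Ico 0 t, φ s ≤ ρ := fun s hs =>
    le_of_not_ge fun hs' => not_lt.2 (hmin ⟨⟨hs.1, hs.2.le.trans ht.2⟩, hs'⟩) hs.2
  have huntil : ∀ s ∈ Set.Icc 0 t, φ s ≤ ρ := by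
    have hφt := hφ.mono (Set.Icc_subset_Icc_right ht.2)
    rw [← closure_Ico ht₀] at hφt ⊢
    exact le_on_closure hbefore hφt continuousOn_const
  exact absurd (hstep t ht huntil) (not_lt.2 hρt)

theorem le_div_one_sub_of_small_gain (hφ : ContinuousOn φ (Set.Icc 0 τ)) (h₀ : φ 0 < ρ)
    (hg : g < 1) (hlt : a + g * ρ < ρ)
    (hgain : ∀ t ∈ Set.Icc 0 τ, ∀ R ≤ ρ, (∀ s ∈ Set.Icc 0 t, φ s ≤ R) → φ t ≤ a + g * R) :
    ∀ t ∈ Set.Icc 0 τ, φ t ≤ a / (1 - g) := by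
  intro t ht
  have hρ := forall_le_of_forall_le_imp_lt hφ h₀ fun t ht hφt =>
    (hgain t ht ρ le_rfl hφt).trans_lt hlt
  obtain ⟨t₀, ht₀, hmax⟩ := isCompact_Icc.exists_isMaxOn ⟨t, ht⟩ hφ
  have hφt₀ : φ t₀ ≤ a + g * φ t₀ := hgain t₀ ht₀ (φ t₀) (hρ t₀ ht₀) fun s hs =>
    hmax ⟨hs.1, hs.2.trans ht₀.2⟩
  refine (hmax ht).trans ((le_div_iff₀ (sub_pos.2 hg)).2 ?_)
  linarith

end SmallGain

/-! ### The reference system -/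

theorem matrixNorm_nonneg {k l : ℕ} (M : Matrix (Fin k) (Fin l) ℝ) : 0 ≤ matrixNorm M :=
  Real.iSup_nonneg fun _ => Finset.sum_nonneg fun _ _ => abs_nonneg _

namespace Design

variable {n m p nz mr : ℕ} (S : Design n m p nz mr) {ω τ : ℝ}

section ClosedLoopTransferMatrices

theorem Hr_eq : S.Hr ω = resolvent S.Am * const S.Bm * (S.C ω * const S.Kg) :=
  Matrix.mul_assoc _ _ _

variable {S}

theorem relativeDegreeGE_H₀ : RelativeDegreeGE 1 S.H₀ := by
  rw [H₀]
  simpa only [add_zero] using (relativeDegreeGE_resolvent S.Am).mul (relativeDegreeGE_const S.Bm)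

theorem relativeDegreeGE_C₀_mul_Kg (hC : RelativeDegreeGE 1 (S.C₀ ω)) :
    RelativeDegreeGE 1 (S.C₀ ω * const S.Kg) := by
  simpa only [add_zero] using hC.mul (relativeDegreeGE_const S.Kg)

theorem relativeDegreeGE_C_mul_Kg (hC : RelativeDegreeGE 1 (S.C₀ ω)) :
    RelativeDegreeGE 1 (S.C ω * const S.Kg) := by
  rw [C, Matrix.smul_mul]
  exact (relativeDegreeGE_C₀_mul_Kg hC).C_smul ω

theorem relativeDegreeGE_one_sub_C (hC : RelativeDegreeGE 1 (S.C₀ ω)) :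
    RelativeDegreeGE 0 (1 - S.C ω) :=
  relativeDegreeGE_one.sub ((hC.C_smul ω).mono zero_le_one)

theorem relativeDegreeGE_Hr (hC : RelativeDegreeGE 1 (S.C₀ ω)) : RelativeDegreeGE 1 (S.Hr ω) := by
  rw [Hr, Matrix.mul_assoc]
  exact (relativeDegreeGE_H₀.mul (relativeDegreeGE_C_mul_Kg hC)).mono one_le_two

theorem relativeDegreeGE_G (hC : RelativeDegreeGE 1 (S.C₀ ω)) : RelativeDegreeGE 1 (S.G ω) := by
  rw [G]
  simpa only [add_zero] using relativeDegreeGE_H₀.mul (relativeDegreeGE_one_sub_C hC)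

theorem isStable_H₀ (hA : IsHurwitz S.Am) : IsStable S.H₀ :=
  hA.isStable_resolvent.mul (isStable_const S.Bm)

theorem isStable_C (hC : IsStable (S.C₀ ω)) : IsStable (S.C ω) :=
  hC.smul (C_mem_stableAlgebra ω)

theorem isStable_Hr (hA : IsHurwitz S.Am) (hC : IsStable (S.C₀ ω)) : IsStable (S.Hr ω) :=
  ((isStable_H₀ hA).mul (isStable_C hC)).mul (isStable_const S.Kg)

theorem isStable_G (hA : IsHurwitz S.Am) (hC : IsStable (S.C₀ ω)) : IsStable (S.G ω) :=
  (isStable_H₀ hA).mul (isStable_one.sub (isStable_C hC))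

end ClosedLoopTransferMatrices

section Bounds

theorem rNorm_nonneg : 0 ≤ S.rNorm := ENNReal.toReal_nonneg

theorem ρext_nonneg (hb : 0 ≤ S.b₀) (ω : ℝ) : 0 ≤ S.ρext ω :=
  add_nonneg (mul_nonneg (l1Norm_nonneg _) S.rNorm_nonneg) (mul_nonneg (l1Norm_nonneg _) hb)

theorem κm_nonneg : 0 ≤ S.κm := Real.iSup_nonneg fun _ => matrixNorm_nonneg _

theorem κx_nonneg (ω : ℝ) : 0 ≤ S.κx ω :=
  add_nonneg (mul_nonneg (l1Norm_nonneg _) (Real.sqrt_nonneg _))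
    (mul_nonneg (l1Norm_nonneg _) (Real.sqrt_nonneg _))

theorem ρint_nonneg (hρ₀ : 0 ≤ S.ρ₀) (ω : ℝ) : 0 ≤ S.ρint ω :=
  mul_nonneg (add_nonneg S.κm_nonneg (S.κx_nonneg ω)) hρ₀

variable {S}

theorem l1Norm_G_mul_L_lt_one (hb : 0 ≤ S.b₀) (hρr : 0 < S.ρr)
    (hG : S.ρext ω + l1Norm (S.G ω) * S.L S.ρr * S.ρr < S.ρr) :
    l1Norm (S.G ω) * S.L S.ρr < 1 := by
  have h := S.ρext_nonneg hb ω
  refine lt_of_mul_lt_mul_right (a := S.ρr) ?_ hρr.le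
  linarith

theorem ρext_div_lt_ρrx (hg : l1Norm (S.G ω) * S.L S.ρr < 1)
    (hG : l1Norm (S.G ω) * S.L S.ρr * S.ρr < S.ρr - S.ρext ω - S.ρint ω) :
    S.ρext ω / (1 - l1Norm (S.G ω) * S.L S.ρr) < S.ρrx ω := by
  rw [ρrx, lt_sub_iff_add_lt, ← add_div, div_lt_iff₀ (sub_pos.2 hg)]
  linarith

theorem norm_response_indicator_r_le {k : ℕ} (hr : MemLp S.r ∞ (volume.restrict (Set.Ici 0)))
    {F : TransferMatrix k mr} (hF : RelativeDegreeGE 1 F) (hs : IsStable F) {t : ℝ} (ht : 0 ≤ t) :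
    ‖response F ((Set.Ici 0).indicator S.r) t‖ ≤ l1Norm F * S.rNorm :=
  norm_response_le hF hs S.rNorm_nonneg ht
    ((ae_norm_indicator_le_toReal_eLpNorm measurableSet_Ici hr).mono fun _ h _ => h)

end Bounds

namespace IsReferenceSolution

variable {S} {x : ℝ → Fin n → ℝ} {u : ℝ → Fin m → ℝ}

theorem continuousOn (h : S.IsReferenceSolution ω τ x u) : ContinuousOn x (Set.Icc 0 τ) :=
  fun t ht => (h.ode t ht).continuousWithinAt

theorem mono (h : S.IsReferenceSolution ω τ x u) {t : ℝ} (ht : t ≤ τ) :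
    S.IsReferenceSolution ω t x u where
  init := h.init
  ode s hs := (h.ode s ⟨hs.1, hs.2.trans ht⟩).mono (Set.Icc_subset_Icc_right ht)
  control s hs := h.control s ⟨hs.1, hs.2.trans ht⟩

theorem control_eq (h : S.IsReferenceSolution ω τ x u)
    (hr : MemLp S.r ∞ (volume.restrict (Set.Ici 0))) {η : ℝ → Fin m → ℝ} (hη : MemLp η ∞)
    (hηx : Set.EqOn η (fun s => S.f (x s) s) (Set.Icc 0 τ)) {t : ℝ} (ht : t ∈ Set.Icc 0 τ) :
    u t = response (S.C₀ ω * const S.Kg) ((Set.Ici 0).indicator S.r) t -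
      response (S.C₀ ω) η t := by
  have hr₀ := (memLp_indicator_iff_restrict measurableSet_Ici).2 hr
  rw [h.control t ht, response_mul_const hr₀,
    ← response_sub_right _ (memLp_top_mulVec S.Kg hr₀) hη]
  refine response_congr _ ht.1 fun s hs => ?_
  simp only [hηx ⟨hs.1, hs.2.trans ht.2⟩, Set.indicator_of_mem (Set.mem_Ici.2 hs.1)]

theorem state_eq (h : S.IsReferenceSolution ω τ x u) (hC : RelativeDegreeGE 1 (S.C₀ ω))
    (hr : MemLp S.r ∞ (volume.restrict (Set.Ici 0))) {η : ℝ → Fin m → ℝ} (hηc : Continuous η)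
    (hη : MemLp η ∞) (hηx : Set.EqOn η (fun s => S.f (x s) s) (Set.Icc 0 τ)) :
    Set.EqOn x (fun t => response (S.Hr ω) ((Set.Ici 0).indicator S.r) t + response (S.G ω) η t)
      (Set.Icc 0 τ) := by
  have hr₀ := (memLp_indicator_iff_restrict measurableSet_Ici).2 hr
  set r := (Set.Ici 0).indicator S.r
  have hCr (t : ℝ) : response (S.C ω * const S.Kg) r t =
      ω • response (S.C₀ ω * const S.Kg) r t := by
    rw [C, Matrix.smul_mul, response_C_smul_left hr₀]
  have hCη (t : ℝ) : response (1 - S.C ω) η t = η t - ω • response (S.C₀ ω) η t := by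
    rw [response_sub_left hη, response_one hη, C, response_C_smul_left hη]
  have hHr (t : ℝ) : HasDerivAt (response (S.Hr ω) r)
      (S.Am *ᵥ response (S.Hr ω) r t + S.Bm *ᵥ response (S.C ω * const S.Kg) r t) t := by
    have hCKg := relativeDegreeGE_C_mul_Kg hC
    rw [Hr_eq]
    exact hasDerivAt_response_resolvent_mul _ _ hr₀ (hCKg.mono zero_le_one) (.inl hCKg) t
  have hG (t : ℝ) : HasDerivAt (response (S.G ω) η)
      (S.Am *ᵥ response (S.G ω) η t + S.Bm *ᵥ response (1 - S.C ω) η t) t :=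
    hasDerivAt_response_resolvent_mul _ _ hη (relativeDegreeGE_one_sub_C hC) (.inr hηc) t
  refine eqOn_Icc_of_hasDerivWithinAt_mulVec_add h.ode (fun t ht => ?_) ?_
  · refine (((hHr t).add (hG t)).congr_deriv ?_).hasDerivWithinAt
    have hu : u t = response (S.C₀ ω * const S.Kg) r t - response (S.C₀ ω) η t :=
      h.control_eq hr hη hηx ht
    have hηt : η t = S.f (x t) t := hηx ht
    rw [hCr, hCη, hu, ← hηt]
    simp only [Matrix.mulVec_add, Matrix.mulVec_sub, smul_sub]
    abel
  · rw [h.init, response_apply_zero (relativeDegreeGE_Hr hC),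
      response_apply_zero (relativeDegreeGE_G hC), add_zero]

theorem norm_state_le_of_norm_f_le (h : S.IsReferenceSolution ω τ x u) (hA : IsHurwitz S.Am)
    (hCs : IsStable (S.C₀ ω)) (hC : RelativeDegreeGE 1 (S.C₀ ω))
    (hr : MemLp S.r ∞ (volume.restrict (Set.Ici 0)))
    (hfx : ContinuousOn (fun s => S.f (x s) s) (Set.Icc 0 τ)) {V : ℝ} (hV : 0 ≤ V)
    (hfV : ∀ s ∈ Set.Icc 0 τ, ‖S.f (x s) s‖ ≤ V) {t : ℝ} (ht : t ∈ Set.Icc 0 τ) :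
    ‖x t‖ ≤ l1Norm (S.Hr ω) * S.rNorm + l1Norm (S.G ω) * V := by
  obtain ⟨η, hηc, hη, hηx⟩ := exists_continuous_memLp_top_eqOn_Icc (ht.1.trans ht.2) hfx
  have hηV : ∀ s ∈ Set.Icc 0 t, ‖η s‖ ≤ V := fun s hs => by
    have hsτ : s ∈ Set.Icc 0 τ := ⟨hs.1, hs.2.trans ht.2⟩
    exact (congrArg norm (hηx hsτ)).trans_le (hfV s hsτ)
  rw [h.state_eq hC hr hηc hη hηx ht]
  exact norm_add_le_of_le
    (norm_response_indicator_r_le hr (relativeDegreeGE_Hr hC) (isStable_Hr hA hCs) ht.1)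
    (norm_response_le (relativeDegreeGE_G hC) (isStable_G hA hCs) hV ht.1
      (Eventually.of_forall hηV))

theorem norm_control_le_of_norm_f_le (h : S.IsReferenceSolution ω τ x u)
    (hCs : IsStable (S.C₀ ω)) (hC : RelativeDegreeGE 1 (S.C₀ ω))
    (hr : MemLp S.r ∞ (volume.restrict (Set.Ici 0)))
    (hfx : ContinuousOn (fun s => S.f (x s) s) (Set.Icc 0 τ)) {V : ℝ} (hV : 0 ≤ V)
    (hfV : ∀ s ∈ Set.Icc 0 τ, ‖S.f (x s) s‖ ≤ V) {t : ℝ} (ht : t ∈ Set.Icc 0 τ) :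
    ‖u t‖ ≤ l1Norm (S.C₀ ω * const S.Kg) * S.rNorm + l1Norm (S.C₀ ω) * V := by
  obtain ⟨η, -, hη, hηx⟩ := exists_continuous_memLp_top_eqOn_Icc (ht.1.trans ht.2) hfx
  have hηV : ∀ s ∈ Set.Icc 0 t, ‖η s‖ ≤ V := fun s hs => by
    have hsτ : s ∈ Set.Icc 0 τ := ⟨hs.1, hs.2.trans ht.2⟩
    exact (congrArg norm (hηx hsτ)).trans_le (hfV s hsτ)
  rw [h.control_eq hr hη hηx ht]
  exact norm_sub_le_of_le
    (norm_response_indicator_r_le hr (relativeDegreeGE_C₀_mul_Kg hC)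
      (hCs.mul (isStable_const S.Kg)) ht.1)
    (norm_response_le hC hCs hV ht.1 (Eventually.of_forall hηV))

theorem continuousOn_f (h : S.IsReferenceSolution ω τ x u)
    (hf : ContinuousOn (fun z : (Fin n → ℝ) × ℝ => S.f z.1 z.2)
      (Metric.closedBall 0 S.ρr ×ˢ Set.Ici 0))
    (hx : ∀ s ∈ Set.Icc 0 τ, ‖x s‖ ≤ S.ρr) :
    ContinuousOn (fun s => S.f (x s) s) (Set.Icc 0 τ) :=
  hf.comp (h.continuousOn.prodMk continuousOn_id) fun s hs =>
    ⟨mem_closedBall_zero_iff.2 (hx s hs), hs.1⟩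

theorem norm_state_le (h : S.IsReferenceSolution ω τ x u) (hA : IsHurwitz S.Am)
    (hCs : IsStable (S.C₀ ω)) (hC : RelativeDegreeGE 1 (S.C₀ ω))
    (hr : MemLp S.r ∞ (volume.restrict (Set.Ici 0)))
    (hf : ContinuousOn (fun z : (Fin n → ℝ) × ℝ => S.f z.1 z.2)
      (Metric.closedBall 0 S.ρr ×ˢ Set.Ici 0))
    (hfb : ∀ x, ‖x‖ ≤ S.ρr → ∀ t, 0 ≤ t → ‖S.f x t‖ ≤ S.L S.ρr * ‖x‖ + S.b₀)
    (hb : 0 ≤ S.b₀) (hρr : 0 < S.ρr) (hL : 0 ≤ S.L S.ρr)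
    (hG : S.ρext ω + l1Norm (S.G ω) * S.L S.ρr * S.ρr < S.ρr) :
    ∀ t ∈ Set.Icc 0 τ, ‖x t‖ ≤ S.ρext ω / (1 - l1Norm (S.G ω) * S.L S.ρr) := by
  refine le_div_one_sub_of_small_gain h.continuousOn.norm (by rwa [h.init, norm_zero])
    (l1Norm_G_mul_L_lt_one hb hρr hG) hG fun t ht R hR hx => ?_
  have ht₀ : (0 : ℝ) ∈ Set.Icc 0 t := Set.left_mem_Icc.2 ht.1
  have hR₀ : 0 ≤ R := (norm_nonneg _).trans (hx 0 ht₀)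
  have hxρ : ∀ s ∈ Set.Icc 0 t, ‖x s‖ ≤ S.ρr := fun s hs => (hx s hs).trans hR
  have hfV : ∀ s ∈ Set.Icc 0 t, ‖S.f (x s) s‖ ≤ S.L S.ρr * R + S.b₀ := fun s hs =>
    (hfb (x s) (hxρ s hs) s hs.1).trans
      (add_le_add_left (mul_le_mul_of_nonneg_left (hx s hs) hL) _)
  have hxt := (h.mono ht.2).norm_state_le_of_norm_f_le hA hCs hC hr
    ((h.mono ht.2).continuousOn_f hf hxρ) (add_nonneg (mul_nonneg hL hR₀) hb) hfV
    (Set.right_mem_Icc.2 ht.1)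
  rw [ρext]
  linarith

end IsReferenceSolution

end Design

namespace Design

variable {n m p nz mr : ℕ} {S : Design n m p nz mr} {ω : ℝ}

section Uncertainty

theorem PlantAssumptions.lipschitzOnWith_f (hP : S.PlantAssumptions) {δ t : ℝ} (hδ : 0 < δ)
    (ht : 0 ≤ t) : LipschitzOnWith (S.d δ).toNNReal (fun x => S.f x t) (Metric.ball 0 δ) :=
  (convex_ball 0 δ).lipschitzOnWith_of_nnnorm_fderiv_le (𝕜 := ℝ)
    (fun x hx => (hP.f_space δ hδ x (mem_ball_zero_iff.1 hx) t ht).1) fun x hx =>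
      NNReal.le_toNNReal_of_coe_le (hP.f_space δ hδ x (mem_ball_zero_iff.1 hx) t ht).2

theorem PlantAssumptions.continuousOn_f (hP : S.PlantAssumptions) {δ : ℝ} (hδ : 0 < δ) :
    ContinuousOn (fun z : (Fin n → ℝ) × ℝ => S.f z.1 z.2) (Metric.ball 0 δ ×ˢ Set.Ici 0) :=
  continuousOn_prod_of_continuousOn_lipschitzOnWith _ (S.d δ).toNNReal
    (fun x hx t ht => (hP.f_time δ hδ x (mem_ball_zero_iff.1 hx) t ht).1.continuousWithinAt)
    fun _ ht => hP.lipschitzOnWith_f hδ ht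

theorem PlantAssumptions.norm_f_le (hP : S.PlantAssumptions) {δ t : ℝ} (hδ : 0 < δ) (ht : 0 ≤ t)
    {x : Fin n → ℝ} (hx : ‖x‖ < δ) : ‖S.f x t‖ ≤ S.d δ * ‖x‖ + S.b₀ := by
  have hlip := (hP.lipschitzOnWith_f hδ ht).norm_sub_le (mem_ball_zero_iff.2 hx)
    (Metric.mem_ball_self hδ)
  rw [Real.coe_toNNReal _ (hP.d_pos δ hδ).le, sub_zero] at hlip
  exact (norm_le_norm_sub_add _ _).trans (add_le_add hlip (hP.f_zero t ht).le)

end Uncertainty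

theorem relativeDegreeGE_Z (S : Design n m p nz mr) : RelativeDegreeGE 0 S.Z :=
  ((((relativeDegreeGE_const S.Cz).mul (relativeDegreeGE_resolvent S.Az)).mul
    (relativeDegreeGE_const S.Bz)).mono zero_le_one).add (relativeDegreeGE_const S.Dz)

namespace Admissible

theorem d_le_L (hS : S.Admissible) : S.d (S.ρr + S.γbar) ≤ S.L S.ρr :=
  le_mul_of_one_le_left (hS.plant.d_pos _ (add_pos hS.ρr_pos hS.γbar_pos)).le
    ((one_le_div hS.ρr_pos).2 (le_add_of_nonneg_right hS.γbar_pos.le))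

theorem L_pos (hS : S.Admissible) : 0 < S.L S.ρr :=
  (hS.plant.d_pos _ (add_pos hS.ρr_pos hS.γbar_pos)).trans_le hS.d_le_L

theorem continuousOn_f (hS : S.Admissible) :
    ContinuousOn (fun z : (Fin n → ℝ) × ℝ => S.f z.1 z.2)
      (Metric.closedBall 0 S.ρr ×ˢ Set.Ici 0) :=
  (hS.plant.continuousOn_f (add_pos hS.ρr_pos hS.γbar_pos)).mono <| Set.prod_mono_left <|
    Metric.closedBall_subset_ball (lt_add_of_pos_right _ hS.γbar_pos)

theorem norm_f_le (hS : S.Admissible) (x : Fin n → ℝ) (hx : ‖x‖ ≤ S.ρr) (t : ℝ) (ht : 0 ≤ t) :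
    ‖S.f x t‖ ≤ S.L S.ρr * ‖x‖ + S.b₀ :=
  (hS.plant.norm_f_le (add_pos hS.ρr_pos hS.γbar_pos) ht
    (hx.trans_lt (lt_add_of_pos_right _ hS.γbar_pos))).trans
      (add_le_add_left (mul_le_mul_of_nonneg_right hS.d_le_L (norm_nonneg x)) _)

theorem l1Norm_G_mul_lt (hS : S.Admissible) (hω : ω ∈ Set.Icc S.ωl S.ωu) :
    l1Norm (S.G ω) * S.L S.ρr * S.ρr < S.ρr - S.ρext ω - S.ρint ω := by
  rw [mul_assoc]
  exact (lt_div_iff₀ (mul_pos hS.L_pos hS.ρr_pos)).1 (hS.l1_condition ω hω)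

theorem C₀_eq_smul_C (hS : S.Admissible) (hω : ω ∈ Set.Icc S.ωl S.ωu) :
    S.C₀ ω = RatFunc.C ω⁻¹ • S.C ω := by
  rw [C, smul_smul, ← map_mul, inv_mul_cancel₀ (hS.plant.ωl_pos.trans_le hω.1).ne', map_one,
    one_smul]

theorem isStable_C₀ (hS : S.Admissible) (hω : ω ∈ Set.Icc S.ωl S.ωu) : IsStable (S.C₀ ω) := by
  rw [hS.C₀_eq_smul_C hω]
  exact (hS.filter_stable ω hω).smul (C_mem_stableAlgebra _)

-- `C = (C Z⁻¹) Z` is the product of a strictly proper and a proper matrix.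
theorem isStrictlyProper_C₀ (hS : S.Admissible) (hω : ω ∈ Set.Icc S.ωl S.ωu) :
    IsStrictlyProper (S.C₀ ω) := by
  have hCZ := (isStrictlyProper_iff_relativeDegreeGE _).1 (hS.filter_strictlyProper ω hω)
  have hC := hCZ.mul (relativeDegreeGE_Z S)
  rw [Matrix.nonsing_inv_mul_cancel_right _ _ hS.interactor.interactor.isUnit_det, add_zero] at hC
  rw [isStrictlyProper_iff_relativeDegreeGE, hS.C₀_eq_smul_C hω]
  exact hC.C_smul _

end Admissible

end Design

end L1Adaptive

end

open L1Adaptive Design in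
theorem lemma4_general {n m p nz mr : ℕ} (S : L1Adaptive.Design n m p nz mr) {ω : ℝ}
    (hA : L1Adaptive.IsHurwitz S.Am) (hC₀ : L1Adaptive.IsStable (S.C₀ ω))
    (hC₀' : L1Adaptive.IsStrictlyProper (S.C₀ ω))
    (hr : MemLp S.r ∞ (volume.restrict (Set.Ici 0)))
    (hf : ContinuousOn (fun z : (Fin n → ℝ) × ℝ => S.f z.1 z.2)
      (Metric.closedBall 0 S.ρr ×ˢ Set.Ici 0))
    (hfb : ∀ x, ‖x‖ ≤ S.ρr → ∀ t, 0 ≤ t → ‖S.f x t‖ ≤ S.L S.ρr * ‖x‖ + S.b₀)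
    (hρr : 0 < S.ρr) (hL : 0 ≤ S.L S.ρr) (hρ₀ : 0 ≤ S.ρ₀)
    (hG : L1Adaptive.l1Norm (S.G ω) * S.L S.ρr * S.ρr < S.ρr - S.ρext ω - S.ρint ω) :
    0 < S.ρrx ω ∧
      ∀ (τ : ℝ) (x : ℝ → Fin n → ℝ) (u : ℝ → Fin m → ℝ),
        S.IsReferenceSolution ω τ x u →
          L1Adaptive.truncNorm τ x ≤ ENNReal.ofReal (S.ρrx ω) ∧
            L1Adaptive.truncNorm τ u ≤ ENNReal.ofReal (S.ρru ω) := by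
  have hC := (isStrictlyProper_iff_relativeDegreeGE _).1 hC₀'
  have hρint := S.ρint_nonneg hρ₀ ω
  have hb : 0 ≤ S.b₀ := by
    simpa using (norm_nonneg _).trans (hfb 0 (by simpa using hρr.le) 0 le_rfl)
  have hgain : S.ρext ω + l1Norm (S.G ω) * S.L S.ρr * S.ρr < S.ρr := by linarith
  have hg := l1Norm_G_mul_L_lt_one hb hρr hgain
  have hlt := ρext_div_lt_ρrx hg hG
  have hρrx := (div_nonneg (S.ρext_nonneg hb ω) (sub_nonneg.2 hg.le)).trans_lt hlt
  have hρrx_le : S.ρrx ω ≤ S.ρr := sub_le_self _ (div_nonneg hρint (sub_nonneg.2 hg.le))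
  refine ⟨hρrx, fun τ x u h => ?_⟩
  have hx : ∀ t ∈ Set.Icc 0 τ, ‖x t‖ ≤ S.ρrx ω := fun t ht =>
    (h.norm_state_le hA hC₀ hC hr hf hfb hb hρr hL hgain t ht).trans hlt.le
  have hxρr : ∀ t ∈ Set.Icc 0 τ, ‖x t‖ ≤ S.ρr := fun t ht => (hx t ht).trans hρrx_le
  have hfx : ∀ t ∈ Set.Icc 0 τ, ‖S.f (x t) t‖ ≤ S.L S.ρr * S.ρrx ω + S.b₀ := fun t ht =>
    (hfb _ (hxρr t ht) t ht.1).trans (add_le_add_left (mul_le_mul_of_nonneg_left (hx t ht) hL) _)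
  refine ⟨truncNorm_le_ofReal hx, truncNorm_le_ofReal fun t ht => ?_⟩
  rw [ρru, add_comm]
  exact h.norm_control_le_of_norm_f_le hC₀ hC hr (h.continuousOn_f hf hxρr)
    (add_nonneg (mul_nonneg hL hρrx.le) hb) hfx ht

theorem lemma4 {n m p nz mr : ℕ} (S : L1Adaptive.Design n m p nz mr) (hS : S.Admissible)
    (ω : ℝ) (hω : ω ∈ Set.Icc S.ωl S.ωu) :
    0 < S.ρrx ω ∧
      ∀ τ : ℝ, 0 < τ → ∀ (x : ℝ → Fin n → ℝ) (u : ℝ → Fin m → ℝ),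
        S.IsReferenceSolution ω τ x u →
          L1Adaptive.truncNorm τ x ≤ ENNReal.ofReal (S.ρrx ω) ∧
            L1Adaptive.truncNorm τ u ≤ ENNReal.ofReal (S.ρru ω) := by
  obtain ⟨hρrx, h⟩ := lemma4_general S hS.plant.Am_hurwitz (hS.isStable_C₀ hω)
    (hS.isStrictlyProper_C₀ hω) hS.r_bounded hS.continuousOn_f hS.norm_f_le hS.ρr_pos hS.L_pos.le
    hS.ρ₀_pos.le (hS.l1Norm_G_mul_lt hω)
  exact ⟨hρrx, fun τ _ => h τ⟩
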